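/- Let $n\ge 1$, let $\mathbb C^{n+1}$ have coordinates $(z,w)=(z_1,\dots,z_n,w)$, and let $M\subset\mathbb C^{n+1}$ be near its point $p=(p_z,p_w)$ a real-analytic hypersurface, $M=\{r=0\}$ with $r$ real-analytic and $dr(p)\ne0$, whose Levi form at $p$ is nondegenerate. Assume that the coordinates are chosen so that $\partial r/\partial w(p)\neq 0$. Then near $p$ the hypersurface $M$ has a complex defining equation $w=\rho(z,\bar z,\bar w)$ with $\rho$ holomorphic near $(p_z,\bar p_z,\bar p_w)$; the Segre variety of a point $(a,b)$ near $p$ is the graph $w(z)=\rho(z,\bar a,\bar b)$. Put $\eta=\rho_z(p_z,\bar p_z,\bar p_w)\in\mathbb C^n$. A *system associated with $M$ at $p$* is a system $$w_{z_kz_l}=\Phi_{kl}(z,w,w'),\qquad k,l=1,\dots,n,\quad w'=(w_{z_1},\dots,w_{z_n}),$$ with $\Phi_{kl}$ holomorphic near $(p,\eta)$, that is satisfied near $p$ by the graphing functions $w(z)=\rho(z,\bar a,\bar b)$ of the Segre varieties of all points $(a,b)$ near $p$. A function $f(x,y)$ holomorphic near $(x_0,y_0)$ is *algebraic in $y$*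 if $\sum_{j=0}^N a_j(x,y)f(x,y)^j\equiv0$ near $(x_0,y_0)$ for some $N$ and some $a_j$, not all identically zero, that are polynomial in $y$ with coefficients holomorphic in $x$ near $x_0$. Let $\mathcal K$ be the field of fractions of the ring of germs at $(x_0,y_0)$ of functions polynomial in $y$ with coefficients holomorphic in $x$. The *transcendence degree in $y$* of a tuple $(f_1,\dots,f_m)$ of such functions is the product $N_1\cdots N_m\in\mathbb N\cup\{\infty\}$, where $N_j$ is the degree of the field extension $\mathcal K(f_1,\dots,f_{j-1})\subset\mathcal K(f_1,\dots,f_j)$. The *jet transcendence degree of $M$ at $p$* is the transcendence degree in $y=w'$, with $x=(z,w)$, near $(p,\eta)$ of the tuple $\Phi=(\Phi_{kl})$. Then: 1. An associated system of $M$ at $p$ exists. 2. The jet transcendence degree of $M$ at $p$ is finite if and only if all $\Phi_{kl}$ of an associated system are algebraic in $w'$. 3. If $M$ is algebraizable at $p$, that is, if some local biholomorphism of $\mathbb C^{n+1}$ defined near $p$ takes the germ of $M$ at $p$ to the germ of a real-algebraic hypersurface (a real-analytic hypersurface that is locally contained in the zero set of a nonzero real polynomial in the real and imaginary parts of the coordinates),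 then the jet transcendence degree of $M$ at $p$ is finite; that is, all functions $\Phi_{kl}$ of the associated system are algebraic in $w'$. -/

import Mathlib

open Filter Topology Polynomial

noncomputable section

namespace JetTranscendence

/-! ### Real hypersurfaces in `ℂⁿ⁺¹` -/

/-- The space `ℂⁿ⁺¹` with coordinates `(z, w) = (z₁, …, zₙ, w)`. -/
abbrev CSpace (n : ℕ) : Type := (Fin n → ℂ) × ℂ

variable {n : ℕ}

/-- `r` is a real-analytic defining function of `M` near the point `p ∈ M`:
`M = {r = 0}` near `p` and `dr ≠ 0` at `p`. -/
structure IsDefiningFunctionAt (M : Set (CSpace n)) (p : CSpace n) (r : CSpace n → ℝ) :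
    Prop where
  analyticAt : AnalyticAt ℝ r p
  map_base : r p = 0
  regular : fderiv ℝ r p ≠ 0
  mem_iff : ∀ᶠ x in 𝓝 p, x ∈ M ↔ r x = 0

/-- `M` is, near its point `p`, a (smooth) real-analytic real hypersurface. -/
def IsRealAnalyticHypersurfaceAt (M : Set (CSpace n)) (p : CSpace n) : Prop :=
  ∃ r, IsDefiningFunctionAt M p r

/-- `∂_ξ g = ∑ⱼ ξⱼ ∂g/∂Zⱼ`, the Wirtinger derivative of type `(1,0)` in the direction `ξ`. -/
def dHol (ξ : CSpace n) (g : CSpace n → ℂ) (x : CSpace n) : ℂ :=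
  (fderiv ℝ g x ξ - Complex.I * fderiv ℝ g x (Complex.I • ξ)) / 2

/-- `∂̄_ξ g = ∑ⱼ (conj ξⱼ) ∂g/∂(conj Zⱼ)`, the Wirtinger derivative of type `(0,1)`. -/
def dAntihol (ξ : CSpace n) (g : CSpace n → ℂ) (x : CSpace n) : ℂ :=
  (fderiv ℝ g x ξ + Complex.I * fderiv ℝ g x (Complex.I • ξ)) / 2

/-- The Levi form `∑ⱼₖ (∂²r/∂Zⱼ∂(conj Zₖ))(p) ξⱼ (conj ηₖ)`. -/
def leviForm (r : CSpace n → ℝ) (p ξ η : CSpace n) : ℂ :=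
  dHol ξ (dAntihol η (fun x => (r x : ℂ))) p

/-- The holomorphic tangent space at `p` of the hypersurface `{r = 0}`. -/
def holTangent (r : CSpace n → ℝ) (p : CSpace n) : Set (CSpace n) :=
  {ξ | dHol ξ (fun x => (r x : ℂ)) p = 0}

/-- `M` is a real-analytic hypersurface near `p`, and its Levi form at `p` is nondegenerate on the
holomorphic tangent space. -/
def IsLeviNondegenerateAt (M : Set (CSpace n)) (p : CSpace n) : Prop :=
  ∃ r, IsDefiningFunctionAt M p r ∧
    ∀ ξ ∈ holTangent r p, ξ ≠ 0 → ∃ η ∈ holTangent r p, leviForm r p ξ η ≠ 0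

/-- The coordinates are admissible for `M` at `p`: the `w`-direction is not in the holomorphic
tangent space, that is `∂r/∂w ≠ 0` at `p`. This is what makes it possible to solve the defining
equation for `w`. -/
def IsTransverseAt (M : Set (CSpace n)) (p : CSpace n) : Prop :=
  ∃ r, IsDefiningFunctionAt M p r ∧ ((0, 1) : CSpace n) ∉ holTangent r p

/-! ### Algebraizability -/

/-- The real coordinates `(Re z, Im z, Re w, Im w)`. -/
def realCoords (x : CSpace n) : Fin n ⊕ Fin n ⊕ Fin 2 → ℝ :=
  Sum.elim (fun j => (x.1 j).re) (Sum.elim (fun j => (x.1 j).im) ![x.2.re, x.2.im])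

/-- `M` is, near `p`, a real-algebraic hypersurface: a hypersurface that is contained in the zero
set of a nonzero real polynomial in the real coordinates. -/
def IsRealAlgebraicHypersurfaceAt (M : Set (CSpace n)) (p : CSpace n) : Prop :=
  IsRealAnalyticHypersurfaceAt M p ∧
    ∃ P : MvPolynomial (Fin n ⊕ Fin n ⊕ Fin 2) ℝ, P ≠ 0 ∧
      ∀ᶠ x in 𝓝 p, x ∈ M → MvPolynomial.eval (realCoords x) P = 0

/-- There is a local biholomorphism of `ℂⁿ⁺¹` (a holomorphic map with invertible derivative) that
takes `p` to `q` and the germ of `M` at `p` to the germ of `M'` at `q`. -/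
def IsBiholomorphicAt (M : Set (CSpace n)) (p : CSpace n) (M' : Set (CSpace n)) (q : CSpace n) :
    Prop :=
  ∃ H : CSpace n → CSpace n, AnalyticAt ℂ H p ∧ Function.Bijective (fderiv ℂ H p) ∧ H p = q ∧
    ∀ᶠ x in 𝓝 p, x ∈ M ↔ H x ∈ M'

/-- `M` is, near `p`, biholomorphic to a real-algebraic hypersurface. -/
def IsAlgebraizableAt (M : Set (CSpace n)) (p : CSpace n) : Prop :=
  ∃ (M' : Set (CSpace n)) (q : CSpace n),
    IsRealAlgebraicHypersurfaceAt M' q ∧ IsBiholomorphicAt M p M' q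

/-! ### The associated system of differential equations -/

/-- `w = ρ(z, conj z, conj w)` is a complex defining equation of `M` near `p`,
with `ρ` holomorphic. -/
structure IsComplexDefiningFunctionAt (M : Set (CSpace n)) (p : CSpace n)
    (ρ : (Fin n → ℂ) × CSpace n → ℂ) : Prop where
  analyticAt : AnalyticAt ℂ ρ (p.1, star p)
  map_base : ρ (p.1, star p) = p.2
  mem_iff : ∀ᶠ x in 𝓝 p, x ∈ M ↔ x.2 = ρ (x.1, star x)

/-- The function `z ↦ ρ(z, conj a, conj b)` whose graph is the Segre variety of `ζ = (a, b)`. -/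
def segreGraph (ρ : (Fin n → ℂ) × CSpace n → ℂ) (ζ : CSpace n) : (Fin n → ℂ) → ℂ :=
  fun z => ρ (z, star ζ)

/-- The holomorphic partial derivative `∂h/∂zₖ`. -/
def pderivZ (k : Fin n) (h : (Fin n → ℂ) → ℂ) : (Fin n → ℂ) → ℂ :=
  fun z => fderiv ℂ h z (Pi.single k 1)

/-- The gradient `(∂h/∂z₁, …, ∂h/∂zₙ)`. -/
def gradZ (h : (Fin n → ℂ) → ℂ) (z : Fin n → ℂ) : Fin n → ℂ :=
  fun k => pderivZ k h z

/-- `w_{zₖzₗ} = Φₖₗ(z, w, w')` is the system associated with `M` at `p`: the `Φₖₗ` are holomorphic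
near `(p, η)`, where `η` is the slope at `p` of the Segre variety of `p`, and the graphing functions
of all Segre varieties of points near `p` satisfy the system near `p`. -/
def IsAssociatedSystemAt (M : Set (CSpace n)) (p : CSpace n) (η : Fin n → ℂ)
    (Φ : Fin n → Fin n → CSpace n × (Fin n → ℂ) → ℂ) : Prop :=
  ∃ ρ, IsComplexDefiningFunctionAt M p ρ ∧ η = gradZ (segreGraph ρ p) p.1 ∧
    (∀ k l, AnalyticAt ℂ (Φ k l) (p, η)) ∧
    ∀ᶠ q : (Fin n → ℂ) × CSpace n in 𝓝 (p.1, p), ∀ k l,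
      pderivZ k (pderivZ l (segreGraph ρ q.2)) q.1 =
        Φ k l ((q.1, segreGraph ρ q.2 q.1), gradZ (segreGraph ρ q.2) q.1)

/-! ### Transcendence degree -/

section TranscendenceDegree

variable {E : Type*} [NormedAddCommGroup E] [NormedSpace ℂ E] {m : ℕ}

/-- Germs at `(x₀, y₀)` of the holomorphic functions of `x` alone, and of the coordinates `yⱼ`. -/
def pseudoPolyGens (x₀ : E) (y₀ : Fin m → ℂ) : Set (Germ (𝓝 (x₀, y₀)) ℂ) :=
  {g | ∃ c : E → ℂ, AnalyticAt ℂ c x₀ ∧ g = ((fun q => c q.1 : E × (Fin m → ℂ) → ℂ) : Germ _ ℂ)} ∪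
  {g | ∃ j, g = ((fun q => q.2 j : E × (Fin m → ℂ) → ℂ) : Germ _ ℂ)}

/-- The ring of germs at `(x₀, y₀)` of functions `a(x, y)` that are polynomial in `y` with
coefficients holomorphic in `x`. -/
def pseudoPolyRing (x₀ : E) (y₀ : Fin m → ℂ) : Subring (Germ (𝓝 (x₀, y₀)) ℂ) :=
  Subring.closure (pseudoPolyGens x₀ y₀)

/-- `f(x, y)` is algebraic in `y` near `(x₀, y₀)`: it is annihilated by a nonzero polynomial
`a₀(x,y) + a₁(x,y) u + … + a_N(x,y) u^N` with all `aⱼ` polynomial in `y` and holomorphic in `x`. -/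
def IsAlgebraicInSecond (x₀ : E) (y₀ : Fin m → ℂ) (f : E × (Fin m → ℂ) → ℂ) : Prop :=
  ∃ P : (pseudoPolyRing x₀ y₀)[X], P ≠ 0 ∧ aeval (f : Germ (𝓝 (x₀, y₀)) ℂ) P = 0

/-- The least degree of a nonzero polynomial over `A` that annihilates `f`, and `∞` if there is
none. When `A` is a domain this is the degree over `Frac A` of the extension generated by `f`. -/
def degreeOver {G : Type*} [CommRing G] (A : Subring G) (f : G) : ℕ∞ :=
  ⨅ (P : A[X]) (_ : P ≠ 0) (_ : aeval f P = 0), (P.natDegree : ℕ∞)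

/-- The transcendence degree in `y` near `(x₀, y₀)` of a vector function `F = (fᵢ)(x, y)`: the
product of the degrees of the successive extensions obtained by adding the components `fᵢ` one
after another to the field of fractions of the ring of functions polynomial in `y`. -/
def transcendenceDegree {ι : Type*} [Fintype ι] [LinearOrder ι] (x₀ : E) (y₀ : Fin m → ℂ)
    (F : ι → E × (Fin m → ℂ) → ℂ) : ℕ∞ :=
  ∏ i, degreeOver
    (Subring.closure (pseudoPolyGens x₀ y₀ ∪
      {g | ∃ j < i, g = (F j : Germ (𝓝 (x₀, y₀)) ℂ)}))
    (F i : Germ (𝓝 (x₀, y₀)) ℂ)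

end TranscendenceDegree

/-- The jet transcendence degree of `M` at `p`: the transcendence degree in `w'` of the function
`Φ = (Φₖₗ)` of the associated system. (The germ of `Φ` is unique, so that the infimum is over a
single value.) -/
def jetTranscendenceDegree (M : Set (CSpace n)) (p : CSpace n) : ℕ∞ :=
  ⨅ (η : Fin n → ℂ) (Φ : Fin n → Fin n → CSpace n × (Fin n → ℂ) → ℂ)
    (_ : IsAssociatedSystemAt M p η Φ),
    transcendenceDegree p η (fun i : Fin n ×ₗ Fin n => Φ (ofLex i).1 (ofLex i).2)

end JetTranscendence

end

noncomputable section

namespace JetTranscendence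

variable {n : ℕ}

/-- The analytic inverse function theorem. -/
theorem exists_analytic_local_inverse {𝕜 E F : Type*} [RCLike 𝕜] [NormedAddCommGroup E]
    [NormedSpace 𝕜 E] [NormedAddCommGroup F] [NormedSpace 𝕜 F] [FiniteDimensional 𝕜 E]
    [FiniteDimensional 𝕜 F] {f : E → F} {a : E} (hf : AnalyticAt 𝕜 f a)
    (hb : Function.Bijective (fderiv 𝕜 f a)) :
    ∃ g : F → E, AnalyticAt 𝕜 g (f a) ∧ g (f a) = a ∧ (∀ᶠ y in 𝓝 (f a), f (g y) = y) ∧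
      ∀ᶠ x in 𝓝 a, g (f x) = x := by
  have := FiniteDimensional.complete 𝕜 E
  have := FiniteDimensional.complete 𝕜 F
  let e : E ≃L[𝕜] F :=
    (LinearEquiv.ofBijective (fderiv 𝕜 f a : E →ₗ[𝕜] F) hb).toContinuousLinearEquiv
  have he : (e : E →L[𝕜] F) = fderiv 𝕜 f a := by ext; rfl
  have hs : HasStrictFDerivAt f (e : E →L[𝕜] F) a := he ▸ hf.hasStrictFDerivAt
  let R := hs.toOpenPartialHomeomorph f
  have hx : a ∈ R.source := hs.mem_toOpenPartialHomeomorph_source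
  refine ⟨R.symm, ?_, R.left_inv hx, ?_, ?_⟩
  · exact R.analyticAt_symm' hx (i := e) hf he.symm
  · exact R.eventually_right_inverse (R.map_source hx)
  · exact R.eventually_left_inverse hx

/-- A real power series, expanded in a real basis, also converges at complex arguments. -/
theorem exists_complexification_basis {E ι : Type*} [NormedAddCommGroup E] [NormedSpace ℝ E]
    [Fintype ι] [FiniteDimensional ℝ E] (b : Module.Basis ι ℝ E) {r : E → ℝ} {p : E}
    (hr : AnalyticAt ℝ r p) :
    ∃ R : (ι → ℂ) → ℂ, AnalyticAt ℂ R 0 ∧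
      ∀ᶠ v in 𝓝 (0 : E), R (fun i => (b.repr v i : ℂ)) = r (p + v) := by
  classical
  obtain ⟨P, hP⟩ := hr
  let C (k : ℕ) (f : Fin k → ι) : ℂ := ((P k (fun j => b (f j)) : ℝ) : ℂ)
  let m (k : ℕ) (f : Fin k → ι) : ContinuousMultilinearMap ℂ (fun _ : Fin k => ι → ℂ) ℂ :=
    (ContinuousMultilinearMap.mkPiAlgebra ℂ (Fin k) ℂ).compContinuousLinearMap
      (fun j => ContinuousLinearMap.proj (f j))
  let S : FormalMultilinearSeries ℂ (ι → ℂ) ℂ := fun k => ∑ f : Fin k → ι, C k f • m k f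
  obtain ⟨ρ, hρ0, hρ⟩ : ∃ ρ : NNReal, 0 < ρ ∧ (ρ : ENNReal) < P.radius := by
    obtain ⟨x, hx0, hx⟩ := ENNReal.lt_iff_exists_nnreal_btwn.1 hP.radius_pos
    exact ⟨x, by exact_mod_cast hx0, hx⟩
  obtain ⟨K, hK0, hK⟩ := P.norm_mul_pow_le_of_lt_radius hρ
  let B : NNReal := ∑ i, ‖b i‖₊
  have hB (i : ι) : ‖b i‖ ≤ B := by
    have := Finset.single_le_sum (f := fun i => ‖b i‖₊) (fun _ _ => zero_le) (Finset.mem_univ i)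
    exact_mod_cast this
  have hm (k : ℕ) (f : Fin k → ι) : ‖m k f‖ ≤ 1 := by
    refine (ContinuousMultilinearMap.norm_compContinuousLinearMap_le _ _).trans ?_
    rw [ContinuousMultilinearMap.norm_mkPiAlgebra, one_mul]
    refine Finset.prod_le_one (fun _ _ => norm_nonneg _) fun j _ => ?_
    refine ContinuousLinearMap.opNorm_le_bound _ zero_le_one fun x => ?_
    rw [one_mul]; exact norm_le_pi_norm x (f j)
  have hC (k : ℕ) (f : Fin k → ι) : ‖C k f‖ ≤ ‖P k‖ * (B : ℝ) ^ k := by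
    rw [Complex.norm_real]
    refine ((P k).le_opNorm _).trans ?_
    gcongr
    refine (Finset.prod_le_prod (fun _ _ => norm_nonneg _) fun j _ => hB (f j)).trans ?_
    simp
  have hS (k : ℕ) : ‖S k‖ ≤ (Fintype.card ι : ℝ) ^ k * (‖P k‖ * (B : ℝ) ^ k) := by
    refine (norm_sum_le _ _).trans ?_
    refine (Finset.sum_le_card_nsmul _ _ (‖P k‖ * (B : ℝ) ^ k) fun f _ => ?_).trans ?_
    · rw [norm_smul]
      exact (mul_le_of_le_one_right (norm_nonneg _) (hm k f)).trans (hC k f)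
    · simp
  let D : NNReal := Fintype.card ι * B + 1
  have hD : 0 < D := by positivity
  have hrad : 0 < S.radius := by
    refine lt_of_lt_of_le ?_ (S.le_radius_of_bound (r := ρ / D) K fun k => ?_)
    · exact_mod_cast div_pos hρ0 hD
    · calc ‖S k‖ * ((ρ / D : NNReal) : ℝ) ^ k
          ≤ ((Fintype.card ι : ℝ) ^ k * (‖P k‖ * (B : ℝ) ^ k)) * ((ρ / D : NNReal) : ℝ) ^ k := by
            gcongr; exact hS k
        _ = (‖P k‖ * (ρ : ℝ) ^ k) * ((Fintype.card ι * B) / D : ℝ) ^ k := by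
            push_cast; rw [div_pow, div_pow, mul_pow]; ring
        _ ≤ (‖P k‖ * (ρ : ℝ) ^ k) * 1 := by
            gcongr
            refine pow_le_one₀ (by positivity) ?_
            rw [div_le_one (by exact_mod_cast hD)]
            simp [D]
        _ ≤ K := by rw [mul_one]; exact hK k
  have hb := S.hasFPowerSeriesOnBall hrad
  refine ⟨S.sum, hb.analyticAt, ?_⟩
  have hcont : ContinuousAt (fun v : E => fun i => ((b.repr v i : ℝ) : ℂ)) 0 := by
    have : Continuous (b.equivFun : E → ι → ℝ) := b.equivFun.toContinuousLinearEquiv.continuous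
    refine (continuous_pi fun i => ?_).continuousAt
    exact Complex.continuous_ofReal.comp ((continuous_apply i).comp this)
  have h0 : (fun i => ((b.repr (0 : E) i : ℝ) : ℂ)) = 0 := by ext; simp
  have hS1 : ∀ᶠ v : E in 𝓝 0, HasSum (fun k => S k fun _ => fun i => ((b.repr v i : ℝ) : ℂ))
      (S.sum (fun i => ((b.repr v i : ℝ) : ℂ))) := by
    have := (hb.hasFPowerSeriesAt.eventually_hasSum)
    rw [← h0] at this
    filter_upwards [hcont.eventually this] with v hv
    rwa [h0, zero_add] at hv
  have hS2 : ∀ᶠ v : E in 𝓝 0, HasSum (fun k => P k fun _ => v) (r (p + v)) := hP.eventually_hasSum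
  filter_upwards [hS1, hS2] with v h1 h2
  refine h1.unique ?_
  have h3 := Complex.hasSum_ofReal.2 h2
  convert h3 using 2 with k
  have hv : v = ∑ i, b.repr v i • b i := (b.sum_repr v).symm
  have : P k (fun _ => v) = ∑ f : Fin k → ι, (∏ j, b.repr v (f j)) * P k (fun j => b (f j)) := by
    conv_lhs => rw [hv]
    rw [(P k).map_sum (fun _ i => b.repr v i • b i)]
    refine Finset.sum_congr rfl fun f _ => ?_
    rw [(P k).map_smul_univ, smul_eq_mul]
  rw [this]
  simp only [S, C, m, _root_.sum_apply, _root_.smul_apply,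
    ContinuousMultilinearMap.compContinuousLinearMap_apply,
    ContinuousMultilinearMap.mkPiAlgebra_apply, ContinuousLinearMap.proj_apply, smul_eq_mul]
  push_cast
  exact Finset.sum_congr rfl fun f _ => mul_comm _ _

/-- A real linear functional `ℓ` on `ℂⁿ⁺¹` is the restriction to `{(x, conj x)}` of a complex
linear functional. -/
theorem exists_complexification_functional (l : CSpace n →L[ℝ] ℝ) :
    ∃ L : (CSpace n × CSpace n) →L[ℂ] ℂ, ∀ x, L (x, star x) = l x := by
  let f : CSpace n → ℂ := fun x => ((l x : ℂ) - Complex.I * (l (Complex.I • x) : ℂ)) / 2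
  have hadd (x y) : f (x + y) = f x + f y := by simp only [f, smul_add, map_add]; push_cast; ring
  have hsmul (c : ℂ) (x) : f (c • x) = c * f x := by
    have h (c : ℂ) (x : CSpace n) : l (c • x) = c.re * l x + c.im * l (Complex.I • x) := by
      have : c • x = c.re • x + c.im • (Complex.I • x) := by
        conv_lhs => rw [← Complex.re_add_im c, add_smul, mul_smul]
        simp only [Complex.coe_smul]
      rw [this, map_add, map_smul, map_smul, smul_eq_mul, smul_eq_mul]
    simp only [f]
    rw [smul_smul, h c, h (Complex.I * c)]
    apply Complex.ext <;> simp <;> ring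
  let g : (CSpace n × CSpace n) →ₗ[ℂ] ℂ :=
    { toFun := fun q => f q.1 + star (f (star q.2))
      map_add' := fun q q' => by
        simp only [Prod.fst_add, Prod.snd_add, hadd, star_add]; ring
      map_smul' := fun c q => by
        simp only [Prod.smul_fst, Prod.smul_snd, hsmul, star_smul, star_mul', star_star,
          RingHom.id_apply, smul_eq_mul]
        ring }
  refine ⟨LinearMap.toContinuousLinearMap g, fun x => ?_⟩
  change f x + star (f (star (star x))) = l x
  rw [star_star]
  apply Complex.ext <;> simp [f] <;> ring

/-- A real-analytic function of `x` is the restriction to `χ = conj x` of a holomorphic function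
of `(x, χ)`. -/
theorem exists_complexification {r : CSpace n → ℝ} {p : CSpace n} (hr : AnalyticAt ℝ r p) :
    ∃ R : CSpace n × CSpace n → ℂ, AnalyticAt ℂ R (p, star p) ∧
      ∀ᶠ x in 𝓝 p, R (x, star x) = r x := by
  let b := Module.finBasis ℝ (CSpace n)
  obtain ⟨R, hR, hRr⟩ := exists_complexification_basis b hr
  have := fun i => exists_complexification_functional
    (LinearMap.toContinuousLinearMap (b.coord i))
  choose L hL using this
  refine ⟨fun q => R (ContinuousLinearMap.pi L (q - (p, star p))), ?_, ?_⟩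
  · refine AnalyticAt.fun_comp (by rwa [sub_self, map_zero]) ?_
    exact ((ContinuousLinearMap.pi L).analyticAt _).fun_comp (by fun_prop)
  · have h : Tendsto (fun x => x - p) (𝓝 p) (𝓝 0) := by
      have : Continuous fun x : CSpace n => x - p := by fun_prop
      simpa using this.tendsto p
    filter_upwards [h.eventually hRr] with x hx
    rw [add_sub_cancel] at hx
    rw [← hx]
    congr 1
    ext i
    have : ((x, star x) : CSpace n × CSpace n) - (p, star p) = (x - p, star (x - p)) := by
      rw [Prod.mk_sub_mk, star_sub]
    rw [this, ContinuousLinearMap.pi_apply, hL]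
    rfl

/-- `{(x, conj x)}` is a set of uniqueness for holomorphic functions of `(x, χ)`. -/
theorem eventually_eq_zero_of_conj {K : CSpace n × CSpace n → ℂ} {p : CSpace n}
    (hK : AnalyticAt ℂ K (p, star p)) (h0 : ∀ᶠ x in 𝓝 p, K (x, star x) = 0) :
    ∀ᶠ q in 𝓝 (p, star p), K q = 0 := by
  obtain ⟨ε, hε, hball⟩ := Metric.eventually_nhds_iff_ball.1
    (hK.eventually_analyticAt.and
      (continuous_fst.continuousAt.eventually h0 : ∀ᶠ q : CSpace n × CSpace n in 𝓝 (p, star p), _))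
  refine Metric.eventually_nhds_iff_ball.2 ⟨ε / 6, by positivity, fun q hq => ?_⟩
  let u := q.1 - p
  let v := q.2 - star p
  let a : CSpace n := (2⁻¹ : ℂ) • (u + star v)
  let b : CSpace n := (-Complex.I / 2) • (u - star v)
  have hu : ‖u‖ < ε / 6 := by
    have := (norm_fst_le (q - (p, star p))).trans_lt (mem_ball_iff_norm.1 hq); exact this
  have hv : ‖v‖ < ε / 6 := by
    have := (norm_snd_le (q - (p, star p))).trans_lt (mem_ball_iff_norm.1 hq); exact this
  have ha : ‖a‖ < ε / 6 := by
    rw [norm_smul]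
    have := norm_add_le u (star v)
    rw [norm_star] at this
    norm_num; linarith
  have hb : ‖b‖ < ε / 6 := by
    rw [norm_smul]
    have := norm_sub_le u (star v)
    rw [norm_star] at this
    norm_num; linarith
  let A : CSpace n × CSpace n := (p, star p) + (a, star a)
  let B : CSpace n × CSpace n := (b, star b)
  let f : ℂ → ℂ := fun s => K (A + s • B)
  have hmem (s : ℂ) (hs : s ∈ Metric.ball (0 : ℂ) 2) : A + s • B ∈ Metric.ball (p, star p) ε := by
    rw [mem_ball_iff_norm]
    have h1 : ‖(a, star a)‖ < ε / 6 := by rw [Prod.norm_def]; simpa using ha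
    have h2 : ‖B‖ < ε / 6 := by rw [Prod.norm_def]; simpa [B] using hb
    have hs' : ‖s‖ < 2 := by simpa using hs
    calc ‖A + s • B - (p, star p)‖ = ‖(a, star a) + s • B‖ := by congr 1; simp only [A]; abel
      _ ≤ ‖(a, star a)‖ + ‖s‖ * ‖B‖ := (norm_add_le _ _).trans (by rw [norm_smul])
      _ < ε := by nlinarith [norm_nonneg B, norm_nonneg s]
  have hf : AnalyticOnNhd ℂ f (Metric.ball 0 2) := fun s hs => by
    have := (hball _ (hmem s hs)).1
    exact AnalyticAt.fun_comp this (by fun_prop)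
  have hreal (t : ℝ) (ht : (t : ℂ) ∈ Metric.ball (0 : ℂ) 2) : f t = 0 := by
    have h1 : A + (t : ℂ) • B = (p + a + (t : ℂ) • b, star (p + a + (t : ℂ) • b)) := by
      ext <;> simp [A, B]
    have h2 := (hball _ (hmem t ht)).2
    simp only [f]
    rw [h1] at h2 ⊢
    exact h2
  have hfreq : ∃ᶠ s in 𝓝[≠] (0 : ℂ), f s = 0 := by
    have ht : Tendsto (fun t : ℝ => (t : ℂ)) (𝓝[≠] 0) (𝓝[≠] (0 : ℂ)) := by
      refine tendsto_nhdsWithin_iff.2 ⟨?_, ?_⟩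
      · exact (Complex.continuous_ofReal.tendsto' 0 0 (by simp)).mono_left nhdsWithin_le_nhds
      · filter_upwards [self_mem_nhdsWithin] with t ht
        simpa using ht
    refine ht.frequently (Eventually.frequently ?_)
    have : ∀ᶠ s in 𝓝[≠] (0 : ℂ), s ∈ Metric.ball (0 : ℂ) 2 :=
      nhdsWithin_le_nhds (Metric.ball_mem_nhds _ two_pos)
    filter_upwards [ht.eventually this] with t ht using hreal t ht
  have := hf.eqOn_zero_of_preconnected_of_frequently_eq_zero
    (convex_ball _ _).isPreconnected (Metric.mem_ball_self two_pos) hfreq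
    (show Complex.I ∈ Metric.ball (0 : ℂ) 2 by simp)
  have hq' : A + Complex.I • B = q := by
    have hI : Complex.I * (-Complex.I / 2) = 2⁻¹ := by
      rw [mul_div_assoc', mul_neg, Complex.I_mul_I]; norm_num
    have hI' : Complex.I * star (-Complex.I / 2) = -2⁻¹ := by
      rw [star_div₀, star_neg]; simp [mul_div_assoc', Complex.I_mul_I]; norm_num
    have h1 : a + Complex.I • b = u := by
      simp only [a, b]; rw [smul_smul, hI]; module
    have h2 : star a + Complex.I • star b = v := by
      simp only [a, b]; rw [star_smul, star_smul, smul_smul, hI']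
      simp only [star_add, star_sub, star_star]
      rw [show star (2⁻¹ : ℂ) = 2⁻¹ by simp]
      module
    refine Prod.ext ?_ ?_
    · change p + a + Complex.I • b = q.1
      rw [add_assoc, h1]; simp [u]
    · change star p + star a + Complex.I • star b = q.2
      rw [add_assoc, h2]; simp [v]
  simpa [f, hq'] using this

theorem continuous_conjGraph :
    Continuous fun x : CSpace n => ((x, star x) : CSpace n × CSpace n) := by fun_prop

theorem fderiv_conjGraph {G : CSpace n × CSpace n → ℂ} {x : CSpace n}
    (hG : DifferentiableAt ℂ G (x, star x)) (v : CSpace n) :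
    fderiv ℝ (fun y => G (y, star y)) x v = fderiv ℂ G (x, star x) (v, star v) := by
  have h1 : HasFDerivAt (fun x : CSpace n => ((x, star x) : CSpace n × CSpace n))
      ((ContinuousLinearMap.id ℝ _).prod (starL' ℝ : CSpace n ≃L[ℝ] CSpace n)) x :=
    (hasFDerivAt_id x).prodMk (starL' ℝ : CSpace n ≃L[ℝ] CSpace n).hasFDerivAt
  have h2 : HasFDerivAt (fun y => G (y, star y)) _ x :=
    (hG.hasFDerivAt.restrictScalars ℝ).comp x h1
  rw [h2.fderiv]
  rfl

theorem dHol_conjGraph {G : CSpace n × CSpace n → ℂ} {x : CSpace n}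
    (hG : DifferentiableAt ℂ G (x, star x)) (ξ : CSpace n) :
    dHol ξ (fun y => G (y, star y)) x = fderiv ℂ G (x, star x) (ξ, 0) := by
  have h1 : (ξ, star ξ) = ((ξ, 0) : CSpace n × CSpace n) + (0, star ξ) := by simp
  have h2 : (Complex.I • ξ, star (Complex.I • ξ)) =
      Complex.I • ((ξ, 0) : CSpace n × CSpace n) - Complex.I • (0, star ξ) := by
    simp [star_smul]
  rw [dHol, fderiv_conjGraph hG, fderiv_conjGraph hG, h1, h2, map_add, map_sub, map_smul, map_smul,
    smul_eq_mul, smul_eq_mul]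
  linear_combination (-(fderiv ℂ G (x, star x) (ξ, 0)) / 2 +
    (fderiv ℂ G (x, star x) (0, star ξ)) / 2) * Complex.I_mul_I

theorem dAntihol_conjGraph {G : CSpace n × CSpace n → ℂ} {x : CSpace n}
    (hG : DifferentiableAt ℂ G (x, star x)) (ξ : CSpace n) :
    dAntihol ξ (fun y => G (y, star y)) x = fderiv ℂ G (x, star x) (0, star ξ) := by
  have h1 : (ξ, star ξ) = ((ξ, 0) : CSpace n × CSpace n) + (0, star ξ) := by simp
  have h2 : (Complex.I • ξ, star (Complex.I • ξ)) =
      Complex.I • ((ξ, 0) : CSpace n × CSpace n) - Complex.I • (0, star ξ) := by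
    simp [star_smul]
  rw [dAntihol, fderiv_conjGraph hG, fderiv_conjGraph hG, h1, h2, map_add, map_sub, map_smul,
    map_smul, smul_eq_mul, smul_eq_mul]
  linear_combination ((fderiv ℂ G (x, star x) (ξ, 0)) / 2 -
    (fderiv ℂ G (x, star x) (0, star ξ)) / 2) * Complex.I_mul_I

theorem dHol_congr {f g : CSpace n → ℂ} {x : CSpace n} (h : f =ᶠ[𝓝 x] g) (ξ : CSpace n) :
    dHol ξ f x = dHol ξ g x := by
  rw [dHol, dHol, h.fderiv_eq]

theorem dAntihol_congr {f g : CSpace n → ℂ} {x : CSpace n} (h : f =ᶠ[𝓝 x] g) (ξ : CSpace n) :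
    dAntihol ξ f x = dAntihol ξ g x := by
  rw [dAntihol, dAntihol, h.fderiv_eq]

theorem analyticAt_clm_sub {𝕜 E F : Type*} [NontriviallyNormedField 𝕜] [NormedAddCommGroup E]
    [NormedSpace 𝕜 E] [NormedAddCommGroup F] [NormedSpace 𝕜 F] (L : E →L[𝕜] F) (P a : E) :
    AnalyticAt 𝕜 (fun q => L (q - P)) a :=
  (L.analyticAt _).fun_comp (analyticAt_id.sub analyticAt_const)

/-- A holomorphic function that vanishes on the real hypersurface `{r = 0}` (seen in
`{(x, conj x)}`) vanishes on the complexification `{R = 0}` of the hypersurface. -/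
theorem eventually_eq_zero_of_hypersurface {r : CSpace n → ℝ} {p : CSpace n}
    (hr : AnalyticAt ℝ r p) (hr0 : r p = 0) (hdr : fderiv ℝ r p ≠ 0)
    {R : CSpace n × CSpace n → ℂ}
    (hR : AnalyticAt ℂ R (p, star p)) (hRr : ∀ᶠ x in 𝓝 p, R (x, star x) = r x)
    {h : CSpace n × CSpace n → ℂ} (hh : AnalyticAt ℂ h (p, star p))
    (h0 : ∀ᶠ x in 𝓝 p, r x = 0 → h (x, star x) = 0) :
    ∀ᶠ q in 𝓝 (p, star p), R q = 0 → h q = 0 := by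
  obtain ⟨v, hv⟩ : ∃ v, fderiv ℝ r p v = 1 := by
    obtain ⟨v, hv⟩ : ∃ v, fderiv ℝ r p v ≠ 0 := by
      by_contra! hc
      exact hdr (ContinuousLinearMap.ext hc)
    exact ⟨(fderiv ℝ r p v)⁻¹ • v, by rw [map_smul, smul_eq_mul, inv_mul_cancel₀ hv]⟩
  obtain ⟨L, hL⟩ := exists_complexification_functional (fderiv ℝ r p)
  let P : CSpace n × CSpace n := (p, star p)
  let V : CSpace n × CSpace n := (v, star v)
  have hLV : L V = 1 := by rw [hL, hv]; simp
  have hRP : R P = 0 := by rw [hRr.self_of_nhds, hr0]; simp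
  -- the derivative of `R` at `P` is `L`
  have hDR : fderiv ℂ R P = L := by
    have hK : ∀ w, fderiv ℂ R P (w, star w) = fderiv ℝ r p w := by
      intro w
      rw [← fderiv_conjGraph hR.differentiableAt, EventuallyEq.fderiv_eq (𝕜 := ℝ) hRr]
      have h3 : HasFDerivAt (fun x => (r x : ℂ)) (Complex.ofRealCLM ∘L fderiv ℝ r p) p :=
        Complex.ofRealCLM.hasFDerivAt.comp p hr.differentiableAt.hasFDerivAt
      rw [h3.fderiv]
      rfl
    have hz := eventually_eq_zero_of_conj (p := (0 : CSpace n))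
      (K := fun q => fderiv ℂ R P q - L q)
      (((fderiv ℂ R P).analyticAt _).sub (L.analyticAt _))
      (Eventually.of_forall fun x => by simp [hK, hL])
    rw [star_zero] at hz
    have hd : HasFDerivAt (fun q => (fderiv ℂ R P - L) q) (fderiv ℂ R P - L) 0 :=
      (fderiv ℂ R P - L).hasFDerivAt
    have hd0 : HasFDerivAt (𝕜 := ℂ) (fun q => (fderiv ℂ R P - L) q) 0 0 :=
      (hasFDerivAt_const (0 : ℂ) (0 : CSpace n × CSpace n)).congr_of_eventuallyEq hz
    exact sub_eq_zero.1 (hd.unique hd0)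
  -- straightening of the hypersurface and its complexification
  let f : CSpace n → CSpace n := fun x => x + (r x - fderiv ℝ r p (x - p)) • v
  let F : CSpace n × CSpace n → CSpace n × CSpace n := fun q => q + (R q - L (q - P)) • V
  have hfA : AnalyticAt ℝ f p :=
    analyticAt_id.add ((hr.sub (analyticAt_clm_sub _ _ _)).smul analyticAt_const)
  have hFA : AnalyticAt ℂ F P :=
    analyticAt_id.add ((AnalyticAt.sub hR (analyticAt_clm_sub _ _ _)).smul analyticAt_const)
  have hfp : f p = p := by simp [f, hr0]
  have hFP : F P = P := by simp [F, hRP]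
  have hDf : fderiv ℝ f p = ContinuousLinearMap.id ℝ _ := by
    have : HasFDerivAt f (ContinuousLinearMap.id ℝ _ + (fderiv ℝ r p - fderiv ℝ r p).smulRight v)
        p := by
      refine (hasFDerivAt_id p).add (HasFDerivAt.smul_const ?_ v)
      refine hr.differentiableAt.hasFDerivAt.sub ?_
      exact (fderiv ℝ r p).hasFDerivAt.comp p ((hasFDerivAt_id p).sub_const p)
    rw [this.fderiv]; simp
  have hDF : fderiv ℂ F P = ContinuousLinearMap.id ℂ _ := by
    have : HasFDerivAt F (ContinuousLinearMap.id ℂ _ + (fderiv ℂ R P - L).smulRight V) P := by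
      refine (hasFDerivAt_id P).add (HasFDerivAt.smul_const ?_ V)
      refine (show AnalyticAt ℂ R P from hR).differentiableAt.hasFDerivAt.sub ?_
      exact L.hasFDerivAt.comp P ((hasFDerivAt_id P).sub_const P)
    rw [this.fderiv, hDR]; simp
  obtain ⟨g, hg, hgp, hfg, -⟩ := exists_analytic_local_inverse hfA
    (by rw [hDf]; exact Function.bijective_id)
  obtain ⟨G, hG, hGP, hFG, hGF⟩ := exists_analytic_local_inverse hFA
    (by rw [hDF]; exact Function.bijective_id)
  rw [hfp] at hg hgp hfg
  rw [hFP] at hG hGP hFG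
  have hgc : Tendsto g (𝓝 p) (𝓝 p) := by have := hg.continuousAt.tendsto; rwa [hgp] at this
  have hGc : Tendsto G (𝓝 P) (𝓝 P) := by have := hG.continuousAt.tendsto; rwa [hGP] at this
  have hFc : Tendsto F (𝓝 P) (𝓝 P) := by have := hFA.continuousAt.tendsto; rwa [hFP] at this
  have hcc : Tendsto (fun x : CSpace n => ((x, star x) : CSpace n × CSpace n)) (𝓝 p) (𝓝 P) :=
    continuous_conjGraph.tendsto p
  -- `F` extends `f`
  have hFf : ∀ᶠ x in 𝓝 p, F (x, star x) = (f x, star (f x)) := by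
    filter_upwards [hRr] with x hx
    have : ((x, star x) : CSpace n × CSpace n) - P = (x - p, star (x - p)) := by
      rw [Prod.mk_sub_mk, star_sub]
    simp only [F, this, hL, hx, f]
    rw [← Complex.ofReal_sub, Complex.coe_smul]
    refine Prod.ext rfl ?_
    simp [V]
  have hGg : ∀ᶠ y in 𝓝 p, G (y, star y) = (g y, star (g y)) := by
    filter_upwards [hgc.eventually hFf, hfg, (hcc.comp hgc).eventually hGF] with y h1 h2 h3
    simp only [Function.comp] at h3
    rw [h1, h2] at h3
    exact h3
  have hrg : ∀ᶠ y in 𝓝 p, r (g y) = fderiv ℝ r p (y - p) := by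
    filter_upwards [hfg] with y hy
    have := congrArg (fun x => fderiv ℝ r p (x - p)) hy
    simp only [f] at this
    rw [add_sub_right_comm, map_add, map_smul, hv, smul_eq_mul, mul_one] at this
    linarith
  let π : CSpace n × CSpace n → CSpace n × CSpace n := fun q => q - L (q - P) • V
  have hπA : AnalyticAt ℂ π P :=
    analyticAt_id.sub ((analyticAt_clm_sub L P P).smul analyticAt_const)
  have hπP : π P = P := by simp [π]
  let k : CSpace n → CSpace n := fun x => x - fderiv ℝ r p (x - p) • v
  have hkc : Tendsto k (𝓝 p) (𝓝 p) := by
    have : Continuous k := by fun_prop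
    simpa [k] using this.tendsto p
  have hπk (x : CSpace n) : π (x, star x) = (k x, star (k x)) := by
    have : ((x, star x) : CSpace n × CSpace n) - P = (x - p, star (x - p)) := by
      rw [Prod.mk_sub_mk, star_sub]
    simp only [π, this, hL, k]
    rw [Complex.coe_smul]
    refine Prod.ext rfl ?_
    simp [V]
  have hz := eventually_eq_zero_of_conj (p := p) (K := fun q => h (G (π q)))
    (by
      refine AnalyticAt.fun_comp (f := fun q => G (π q)) ?_ (AnalyticAt.fun_comp ?_ hπA)
      · change AnalyticAt ℂ h (G (π P)); rwa [hπP, hGP]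
      · change AnalyticAt ℂ G (π P); rwa [hπP])
    (by
      filter_upwards [hkc.eventually hGg, hkc.eventually hrg, (hgc.comp hkc).eventually h0]
        with x h1 h2 h3
      rw [hπk, h1]
      refine h3 ?_
      simp only [Function.comp]
      rw [h2]
      simp [k, hv, sub_right_comm])
  filter_upwards [hFc.eventually hz, hGF] with q h1 h2 h3
  have : π (F q) = F q := by
    have : L (F q - P) = 0 := by
      simp only [F]
      rw [add_sub_right_comm, map_add, map_smul, hLV, h3]
      simp
    simp only [π, this, zero_smul, sub_zero]
  rwa [this, h2] at h1

/-- The complex defining equation of a hypersurface. -/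
theorem exists_complexDefiningFunction {r : CSpace n → ℝ} {p : CSpace n} {M : Set (CSpace n)}
    (hr : IsDefiningFunctionAt M p r) (hw : ((0, 1) : CSpace n) ∉ holTangent r p) :
    ∃ ρ : (Fin n → ℂ) × CSpace n → ℂ, IsComplexDefiningFunctionAt M p ρ ∧
      ∀ h : CSpace n × CSpace n → ℂ, AnalyticAt ℂ h (p, star p) →
        (∀ᶠ x in 𝓝 p, x ∈ M → h (x, star x) = 0) →
        ∀ᶠ q in 𝓝 (p.1, star p), h ((q.1, ρ q), q.2) = 0 := by
  obtain ⟨R, hR, hRr⟩ := exists_complexification hr.analyticAt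
  have hRw : fderiv ℂ R (p, star p) ((0, 1), 0) ≠ 0 := by
    rw [← dHol_conjGraph hR.differentiableAt, dHol_congr hRr]
    exact hw
  let P : CSpace n × CSpace n := (p, star p)
  have hRP : R P = 0 := by rw [hRr.self_of_nhds, hr.map_base]; simp
  let F : CSpace n × CSpace n → CSpace n × CSpace n := fun q => ((q.1.1, R q), q.2)
  let D : (CSpace n × CSpace n) →L[ℂ] (CSpace n × CSpace n) :=
    (((ContinuousLinearMap.fst ℂ _ _).comp (ContinuousLinearMap.fst ℂ _ _)).prod
      (fderiv ℂ R P)).prod (ContinuousLinearMap.snd ℂ _ _)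
  have hFA : AnalyticAt ℂ F P :=
    (((analyticAt_fst.comp analyticAt_fst).prod hR).prod analyticAt_snd)
  have hFD : HasFDerivAt F D P :=
    ((hasFDerivAt_fst.comp P hasFDerivAt_fst).prodMk
      (show AnalyticAt ℂ R P from hR).differentiableAt.hasFDerivAt).prodMk hasFDerivAt_snd
  have hDinj : Function.Injective D := by
    refine (injective_iff_map_eq_zero D).2 fun q hq => ?_
    have h1 : q.1.1 = 0 := congrArg (fun t => t.1.1) hq
    have h2 : fderiv ℂ R P q = 0 := congrArg (fun t => t.1.2) hq
    have h3 : q.2 = 0 := congrArg (fun t => t.2) hq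
    have h4 : q = q.1.2 • (((0, 1), 0) : CSpace n × CSpace n) := by
      refine Prod.ext (Prod.ext ?_ ?_) ?_
      · simp [h1]
      · simp
      · simp [h3]
    rw [h4, map_smul, smul_eq_mul, mul_eq_zero, or_iff_left hRw] at h2
    rw [h4, h2, zero_smul]
  have hDb : Function.Bijective (fderiv ℂ F P) := by
    rw [hFD.fderiv]
    exact ⟨hDinj, (LinearMap.injective_iff_surjective (f := D.toLinearMap)).1 hDinj⟩
  obtain ⟨G, hG, hGP, hFG, hGF⟩ := exists_analytic_local_inverse hFA hDb
  have hFP : F P = ((p.1, 0), star p) := by simp only [F, hRP]; rfl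
  rw [hFP] at hG hGP hFG
  let j : (Fin n → ℂ) × CSpace n → CSpace n × CSpace n := fun q => ((q.1, 0), q.2)
  let ρ : (Fin n → ℂ) × CSpace n → ℂ := fun q => (G (j q)).1.2
  have hjA : AnalyticAt ℂ j (p.1, star p) :=
    (analyticAt_fst.prod analyticAt_const).prod analyticAt_snd
  have hρA : AnalyticAt ℂ ρ (p.1, star p) :=
    analyticAt_snd.fun_comp (analyticAt_fst.fun_comp (AnalyticAt.fun_comp (f := j) hG hjA))
  have hρ0 : ρ (p.1, star p) = p.2 := by
    change (G ((p.1, 0), star p)).1.2 = p.2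
    rw [hGP]
  have hFG' : ∀ᶠ q in 𝓝 (p.1, star p), R ((q.1, ρ q), q.2) = 0 := by
    filter_upwards [hjA.continuousAt.tendsto.eventually hFG] with q hq
    have h1 : (G (j q)).1.1 = q.1 := congrArg (fun t => t.1.1) hq
    have h2 : R (G (j q)) = 0 := congrArg (fun t => t.1.2) hq
    have h3 : (G (j q)).2 = q.2 := congrArg (fun t => t.2) hq
    rw [← h1, ← h3]
    exact h2
  have hlift : Tendsto (fun q : (Fin n → ℂ) × CSpace n => ((q.1, ρ q), q.2))
      (𝓝 (p.1, star p)) (𝓝 P) := by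
    have : ContinuousAt (fun q : (Fin n → ℂ) × CSpace n => ((q.1, ρ q), q.2)) (p.1, star p) :=
      (continuousAt_fst.prodMk hρA.continuousAt).prodMk continuousAt_snd
    have h := this.tendsto
    rw [hρ0] at h
    exact h
  have hsol : ∀ᶠ q in 𝓝 P, R q = 0 → q.1.2 = ρ (q.1.1, q.2) := by
    filter_upwards [hGF] with q hq h0
    have : F q = j (q.1.1, q.2) := by simp only [F, h0, j]
    simp only [ρ]
    rw [← this, hq]
  refine ⟨ρ, ⟨hρA, hρ0, ?_⟩, fun h hh h0 => ?_⟩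
  · have hc : Tendsto (fun x : CSpace n => (x.1, star x)) (𝓝 p) (𝓝 (p.1, star p)) := by
      have : Continuous fun x : CSpace n => (x.1, star x) := by fun_prop
      exact this.tendsto p
    filter_upwards [hr.mem_iff, hRr, (continuous_conjGraph.tendsto p).eventually hsol,
      hc.eventually hFG'] with x h1 h2 h3 h4
    rw [h1]
    refine ⟨fun h => h3 (by rw [h2, h]; simp), fun h => ?_⟩
    rw [← h, Prod.mk.eta, h2] at h4
    exact_mod_cast h4
  · have := eventually_eq_zero_of_hypersurface hr.analyticAt hr.map_base hr.regular hR hRr hh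
      (by filter_upwards [h0, hr.mem_iff] with x h1 h2 h3 using h1 (h2.2 h3))
    filter_upwards [hlift.eventually this, hFG'] with q h1 h2 using h1 h2

theorem hasFDerivAt_fderiv_apply {𝕜 E F : Type*} [RCLike 𝕜] [NormedAddCommGroup E]
    [NormedSpace 𝕜 E] [NormedAddCommGroup F] [NormedSpace 𝕜 F] [CompleteSpace F] {f : E → F} {x : E}
    (hf : AnalyticAt 𝕜 f x) (v : E) :
    HasFDerivAt (fun y => fderiv 𝕜 f y v) ((fderiv 𝕜 (fderiv 𝕜 f) x).flip v) x :=
  (ContinuousLinearMap.apply 𝕜 F v).hasFDerivAt.comp x hf.fderiv.differentiableAt.hasFDerivAt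

theorem fderiv_ofReal_comp {r : CSpace n → ℝ} {x : CSpace n} (hr : DifferentiableAt ℝ r x)
    (v : CSpace n) : fderiv ℝ (fun y => (r y : ℂ)) x v = (fderiv ℝ r x v : ℂ) := by
  have h : HasFDerivAt (fun x => (r x : ℂ)) (Complex.ofRealCLM ∘L fderiv ℝ r x) x :=
    Complex.ofRealCLM.hasFDerivAt.comp x hr.hasFDerivAt
  rw [h.fderiv]
  rfl

theorem star_dHol_ofReal {r : CSpace n → ℝ} {x : CSpace n} (hr : DifferentiableAt ℝ r x)
    (ξ : CSpace n) :
    star (dHol ξ (fun y => (r y : ℂ)) x) = dAntihol ξ (fun y => (r y : ℂ)) x := by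
  simp only [dHol, dAntihol, fderiv_ofReal_comp hr]
  apply Complex.ext <;> simp

theorem fderiv_eq_zero_of_dHol {r : CSpace n → ℝ} {x : CSpace n} (hr : DifferentiableAt ℝ r x)
    (h : ∀ ξ, dHol ξ (fun y => (r y : ℂ)) x = 0) : fderiv ℝ r x = 0 := by
  refine ContinuousLinearMap.ext fun ξ => ?_
  have := congrArg Complex.re (h ξ)
  simp only [dHol, fderiv_ofReal_comp hr] at this
  simpa using this

/-- The Levi form is Hermitian. -/
theorem star_leviForm {r : CSpace n → ℝ} {p : CSpace n} (hr : AnalyticAt ℝ r p)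
    (ξ η : CSpace n) : star (leviForm r p ξ η) = leviForm r p η ξ := by
  have hev (η : CSpace n) : dAntihol η (fun y => (r y : ℂ)) =ᶠ[𝓝 p]
      fun x => ((fderiv ℝ r x η : ℂ) + Complex.I * (fderiv ℝ r x (Complex.I • η) : ℂ)) / 2 := by
    filter_upwards [hr.eventually_analyticAt] with x hx
    simp only [dAntihol, fderiv_ofReal_comp hx.differentiableAt]
  have h1 (η : CSpace n) : HasFDerivAt (fun x => (fderiv ℝ r x η : ℂ))
      (Complex.ofRealCLM ∘L (fderiv ℝ (fderiv ℝ r) p).flip η) p :=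
    Complex.ofRealCLM.hasFDerivAt.comp p (hasFDerivAt_fderiv_apply hr η)
  have h2 (ξ η : CSpace n) :
      fderiv ℝ (dAntihol η (fun y => (r y : ℂ))) p ξ =
        ((fderiv ℝ (fderiv ℝ r) p ξ η : ℂ) +
          Complex.I * (fderiv ℝ (fderiv ℝ r) p ξ (Complex.I • η) : ℂ)) / 2 := by
    rw [(hev η).fderiv_eq]
    have h := (((h1 η).add ((h1 (Complex.I • η)).const_mul Complex.I)).mul_const (2⁻¹ : ℂ))
    simp only [div_eq_mul_inv]
    erw [h.fderiv]
    simp [mul_comm, mul_add]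
  have hsym (v w) : fderiv ℝ (fderiv ℝ r) p v w = fderiv ℝ (fderiv ℝ r) p w v :=
    (hr.contDiffAt (n := 2)).isSymmSndFDerivAt (by simp) v w
  rw [leviForm, leviForm, dHol, dHol, h2, h2, h2, h2, hsym η ξ, hsym η (Complex.I • ξ),
    hsym (Complex.I • η) ξ, hsym (Complex.I • η) (Complex.I • ξ)]
  apply Complex.ext <;> simp <;> ring

theorem leviForm_eq_complexification {r : CSpace n → ℝ} {p : CSpace n}
    {R : CSpace n × CSpace n → ℂ} (hR : AnalyticAt ℂ R (p, star p))
    (hRr : ∀ᶠ x in 𝓝 p, R (x, star x) = r x) (ξ η : CSpace n) :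
    leviForm r p ξ η = fderiv ℂ (fderiv ℂ R) (p, star p) (ξ, 0) (0, star η) := by
  have h1 : dAntihol η (fun y => (r y : ℂ)) =ᶠ[𝓝 p]
      fun x => fderiv ℂ R (x, star x) (0, star η) := by
    filter_upwards [hRr.eventually_nhds,
      (continuous_conjGraph.tendsto p).eventually hR.eventually_analyticAt] with x h1 h2
    rw [← dAntihol_conjGraph h2.differentiableAt]
    exact (dAntihol_congr h1 η).symm
  have hd : HasFDerivAt (fun q => fderiv ℂ R q (0, star η)) _ (p, star p) :=
    hasFDerivAt_fderiv_apply hR (0, star η)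
  rw [leviForm, dHol_congr h1,
    dHol_conjGraph (G := fun q => fderiv ℂ R q (0, star η)) hd.differentiableAt, hd.fderiv]
  rfl

/-- The partial derivative in `zₖ` of a function of `(z, χ)`. -/
def dZ (k : Fin n) (f : (Fin n → ℂ) × CSpace n → ℂ) (q : (Fin n → ℂ) × CSpace n) : ℂ :=
  fderiv ℂ f q (Pi.single k 1, 0)

theorem analyticAt_dZ {k : Fin n} {f : (Fin n → ℂ) × CSpace n → ℂ} {q : (Fin n → ℂ) × CSpace n}
    (hf : AnalyticAt ℂ f q) : AnalyticAt ℂ (dZ k f) q :=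
  ((ContinuousLinearMap.apply ℂ ℂ ((Pi.single k 1, 0) : (Fin n → ℂ) × CSpace n)).analyticAt
    _).fun_comp hf.fderiv

theorem dZ_congr {k : Fin n} {f g : (Fin n → ℂ) × CSpace n → ℂ} {q : (Fin n → ℂ) × CSpace n}
    (h : f =ᶠ[𝓝 q] g) : dZ k f =ᶠ[𝓝 q] dZ k g := by
  filter_upwards [h.eventually_nhds] with x hx
  rw [dZ, dZ, EventuallyEq.fderiv_eq hx]

theorem pderivZ_slice {k : Fin n} {f : (Fin n → ℂ) × CSpace n → ℂ} {z : Fin n → ℂ} {χ : CSpace n}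
    (hf : DifferentiableAt ℂ f (z, χ)) : pderivZ k (fun z => f (z, χ)) z = dZ k f (z, χ) := by
  have h : HasFDerivAt (fun z => f (z, χ)) _ z :=
    hf.hasFDerivAt.comp z (hasFDerivAt_prodMk_left z χ)
  rw [pderivZ, h.fderiv]
  rfl

theorem pderivZ_pderivZ_slice {k l : Fin n} {f : (Fin n → ℂ) × CSpace n → ℂ} {z : Fin n → ℂ}
    {χ : CSpace n} (hf : AnalyticAt ℂ f (z, χ)) :
    pderivZ k (pderivZ l (fun z => f (z, χ))) z = dZ k (dZ l f) (z, χ) := by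
  have hc : Tendsto (fun z : Fin n → ℂ => (z, χ)) (𝓝 z) (𝓝 (z, χ)) := by
    have : Continuous fun z : Fin n → ℂ => (z, χ) := by fun_prop
    exact this.tendsto z
  have h : pderivZ l (fun z => f (z, χ)) =ᶠ[𝓝 z] fun z => dZ l f (z, χ) := by
    filter_upwards [hc.eventually hf.eventually_analyticAt] with y hy
    exact pderivZ_slice hy.differentiableAt
  rw [← pderivZ_slice (analyticAt_dZ hf).differentiableAt, pderivZ, h.fderiv_eq]
  rfl

/-- Differentiation along the graph of `ρ` of a holomorphic function of `(z, w, χ)`. -/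
theorem hasFDerivAt_graph {ρ : (Fin n → ℂ) × CSpace n → ℂ} {S : CSpace n × CSpace n → ℂ}
    {q : (Fin n → ℂ) × CSpace n} (hρ : DifferentiableAt ℂ ρ q)
    (hS : DifferentiableAt ℂ S ((q.1, ρ q), q.2)) :
    HasFDerivAt (fun q => S ((q.1, ρ q), q.2))
      (fderiv ℂ S ((q.1, ρ q), q.2) ∘L
        (((ContinuousLinearMap.fst ℂ _ _).prod (fderiv ℂ ρ q)).prod (ContinuousLinearMap.snd ℂ _ _)))
      q := by
  have h : HasFDerivAt (fun q : (Fin n → ℂ) × CSpace n => ((q.1, ρ q), q.2)) _ q :=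
    (hasFDerivAt_fst.prodMk hρ.hasFDerivAt).prodMk hasFDerivAt_snd
  exact hS.hasFDerivAt.comp q h

theorem dZ_graph {ρ : (Fin n → ℂ) × CSpace n → ℂ} {S : CSpace n × CSpace n → ℂ}
    {q : (Fin n → ℂ) × CSpace n} (hρ : DifferentiableAt ℂ ρ q)
    (hS : DifferentiableAt ℂ S ((q.1, ρ q), q.2)) (k : Fin n) :
    dZ k (fun q => S ((q.1, ρ q), q.2)) q =
      fderiv ℂ S ((q.1, ρ q), q.2) ((Pi.single k 1, 0), 0) +
        dZ k ρ q * fderiv ℂ S ((q.1, ρ q), q.2) ((0, 1), 0) := by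
  rw [dZ, (hasFDerivAt_graph hρ hS).fderiv]
  have : (((Pi.single k 1, dZ k ρ q), 0) : CSpace n × CSpace n) =
    ((Pi.single k 1, 0), 0) + dZ k ρ q • ((0, 1), 0) := by simp
  rw [← smul_eq_mul, ← map_smul, ← map_add, ← this]
  rfl

/-- The map `(z, χ) ↦ (z, ρ(z, χ), ρ_z(z, χ))`. -/
def jetMap (ρ : (Fin n → ℂ) × CSpace n → ℂ) (q : (Fin n → ℂ) × CSpace n) :
    CSpace n × (Fin n → ℂ) :=
  ((q.1, ρ q), fun k => dZ k ρ q)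

theorem analyticAt_jetMap {ρ : (Fin n → ℂ) × CSpace n → ℂ} {q : (Fin n → ℂ) × CSpace n}
    (hρ : AnalyticAt ℂ ρ q) : AnalyticAt ℂ (jetMap ρ) q :=
  (analyticAt_fst.prod hρ).prod (AnalyticAt.pi fun _ => analyticAt_dZ hρ)

theorem prodMk_zero_eq_sum (η : CSpace n) : ((η, 0) : CSpace n × CSpace n) =
    ∑ k, η.1 k • ((Pi.single k 1, 0), 0) + η.2 • ((0, 1), 0) := by
  refine Prod.ext (Prod.ext ?_ ?_) ?_
  · simp only [Prod.fst_add, Prod.fst_sum, Prod.smul_fst, smul_zero, add_zero]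
    simp only [← Pi.single_smul, smul_eq_mul, mul_one]
    exact (Finset.univ_sum_single η.1).symm
  · simp [Prod.snd_sum, Prod.fst_sum]
  · simp [Prod.snd_sum]

/-- Levi nondegeneracy: the Segre varieties are parametrized by their 1-jets. -/
theorem bijective_fderiv_jetMap {r : CSpace n → ℝ} {p : CSpace n} (hr : AnalyticAt ℝ r p)
    (hdr : fderiv ℝ r p ≠ 0)
    (hlevi : ∀ ξ ∈ holTangent r p, ξ ≠ 0 → ∃ η ∈ holTangent r p, leviForm r p ξ η ≠ 0)
    {R : CSpace n × CSpace n → ℂ} (hR : AnalyticAt ℂ R (p, star p))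
    (hRr : ∀ᶠ x in 𝓝 p, R (x, star x) = r x)
    {ρ : (Fin n → ℂ) × CSpace n → ℂ} (hρ : AnalyticAt ℂ ρ (p.1, star p))
    (hρ0 : ρ (p.1, star p) = p.2)
    (hRρ : ∀ᶠ q in 𝓝 (p.1, star p), R ((q.1, ρ q), q.2) = 0) :
    Function.Bijective (fderiv ℂ (jetMap ρ) (p.1, star p)) := by
  let P : CSpace n × CSpace n := (p, star p)
  let Q : (Fin n → ℂ) × CSpace n := (p.1, star p)
  let c : (Fin n → ℂ) × CSpace n → CSpace n × CSpace n := fun q => ((q.1, ρ q), q.2)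
  have hcQ : c Q = P := by simp only [c, Q, hρ0]; rfl
  have hcA : AnalyticAt ℂ c Q := (analyticAt_fst.prod hρ).prod analyticAt_snd
  have hcD : HasFDerivAt c (((ContinuousLinearMap.fst ℂ _ _).prod (fderiv ℂ ρ Q)).prod
      (ContinuousLinearMap.snd ℂ _ _)) Q :=
    (hasFDerivAt_fst.prodMk hρ.differentiableAt.hasFDerivAt).prodMk hasFDerivAt_snd
  have hcT : Tendsto c (𝓝 Q) (𝓝 P) := by have := hcA.continuousAt.tendsto; rwa [hcQ] at this
  have hRx (ξ : CSpace n) : fderiv ℂ R P (ξ, 0) = dHol ξ (fun y => (r y : ℂ)) p := by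
    rw [← dHol_conjGraph hR.differentiableAt, dHol_congr hRr]
  have hRχ (ξ : CSpace n) : fderiv ℂ R P (0, star ξ) = dAntihol ξ (fun y => (r y : ℂ)) p := by
    rw [← dAntihol_conjGraph hR.differentiableAt, dAntihol_congr hRr]
  -- the equation differentiated once
  have hg : ∀ᶠ q in 𝓝 Q, ∀ k, fderiv ℂ R (c q) ((Pi.single k 1, 0), 0) +
      dZ k ρ q * fderiv ℂ R (c q) ((0, 1), 0) = 0 := by
    filter_upwards [hRρ.eventually_nhds, hcT.eventually hR.eventually_analyticAt,
      hρ.eventually_analyticAt] with q h1 h2 h3 k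
    rw [← dZ_graph h3.differentiableAt h2.differentiableAt, dZ,
      EventuallyEq.fderiv_eq (f := fun _ => (0 : ℂ)) h1]
    simp
  have hgP (k) : fderiv ℂ R P ((Pi.single k 1, 0), 0) +
      dZ k ρ Q * fderiv ℂ R P ((0, 1), 0) = 0 := by
    have := hg.self_of_nhds k
    rwa [hcQ] at this
  have hRw : fderiv ℂ R P ((0, 1), 0) ≠ 0 := by
    intro h0
    refine hdr (fderiv_eq_zero_of_dHol hr.differentiableAt fun ξ => ?_)
    rw [← hRx, prodMk_zero_eq_sum, map_add, map_sum, map_smul, h0, smul_zero, add_zero]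
    refine Finset.sum_eq_zero fun k _ => ?_
    have := hgP k
    rw [h0, mul_zero, add_zero] at this
    rw [map_smul, this, smul_zero]
  -- the derivative of the jet map
  have hJ : HasFDerivAt (jetMap ρ)
      (((ContinuousLinearMap.fst ℂ _ _).prod (fderiv ℂ ρ Q)).prod
        (ContinuousLinearMap.pi fun k => fderiv ℂ (dZ k ρ) Q)) Q :=
    (hasFDerivAt_fst.prodMk hρ.differentiableAt.hasFDerivAt).prodMk
      (hasFDerivAt_pi.2 fun k => (analyticAt_dZ hρ).differentiableAt.hasFDerivAt)
  have hinj : Function.Injective (fderiv ℂ (jetMap ρ) Q) := by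
    rw [hJ.fderiv]
    refine (injective_iff_map_eq_zero _).2 fun q hq => ?_
    obtain ⟨δz, δ⟩ := q
    have h1 : δz = 0 := congrArg (fun t => t.1.1) hq
    subst h1
    have h2 : fderiv ℂ ρ Q (0, δ) = 0 := congrArg (fun t => t.1.2) hq
    have h3 (k) : fderiv ℂ (dZ k ρ) Q (0, δ) = 0 := congrArg (fun t => t.2 k) hq
    have hRδ : fderiv ℂ R P (0, δ) = 0 := by
      have := (hasFDerivAt_graph (q := Q) (S := R) hρ.differentiableAt
        (by change DifferentiableAt ℂ R (c Q); rw [hcQ]; exact hR.differentiableAt)).fderiv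
      rw [EventuallyEq.fderiv_eq (f := fun _ => (0 : ℂ)) hRρ, fderiv_fun_const] at this
      have := congrArg (fun l => l (0, δ)) this
      change 0 = fderiv ℂ R (c Q) ((0, fderiv ℂ ρ Q (0, δ)), δ) at this
      rw [h2, hcQ] at this
      exact this.symm
    have hD2 (v : CSpace n × CSpace n) :
        HasFDerivAt (fun q => fderiv ℂ R (c q) v) _ Q :=
      HasFDerivAt.comp Q (g := fun y => fderiv ℂ R y v)
        (by rw [hcQ]; exact hasFDerivAt_fderiv_apply hR v) hcD
    have hsec (k) : fderiv ℂ (fderiv ℂ R) P (0, δ) ((Pi.single k 1, 0), 0) +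
        dZ k ρ Q * fderiv ℂ (fderiv ℂ R) P (0, δ) ((0, 1), 0) = 0 := by
      have hs := (hD2 ((Pi.single k 1, 0), 0)).add
        ((analyticAt_dZ (k := k) hρ).differentiableAt.hasFDerivAt.mul (hD2 ((0, 1), 0)))
      have h0 := hs.unique ((hasFDerivAt_const (0 : ℂ) Q).congr_of_eventuallyEq
        (by filter_upwards [hg] with q hq using hq k))
      have := congrArg (fun l => l (0, δ)) h0
      have hP0 : (((0, fderiv ℂ ρ Q (0, δ)), δ) : CSpace n × CSpace n) = (0, δ) := by
        rw [h2]; rfl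
      change fderiv ℂ (fderiv ℂ R) P ((0, fderiv ℂ ρ Q (0, δ)), δ) ((Pi.single k 1, 0), 0) +
        (dZ k ρ Q * fderiv ℂ (fderiv ℂ R) P ((0, fderiv ℂ ρ Q (0, δ)), δ) ((0, 1), 0) +
          fderiv ℂ R (c Q) ((0, 1), 0) * fderiv ℂ (dZ k ρ) Q (0, δ)) = 0 at this
      rwa [hP0, h3, mul_zero, add_zero] at this
    by_contra hne
    have hδ : star δ ≠ 0 := fun h => hne (by rw [star_eq_zero.1 h]; rfl)
    have hT : star δ ∈ holTangent r p := by
      have : star (dHol (star δ) (fun y => (r y : ℂ)) p) = 0 := by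
        rw [star_dHol_ofReal hr.differentiableAt, ← hRχ, star_star, hRδ]
      exact star_eq_zero.1 this
    obtain ⟨η, hη, hl⟩ := hlevi _ hT hδ
    apply hl
    rw [← star_eq_zero, star_leviForm hr, leviForm_eq_complexification hR hRr, star_star]
    have hsym : fderiv ℂ (fderiv ℂ R) P (η, 0) (0, δ) = fderiv ℂ (fderiv ℂ R) P (0, δ) (η, 0) :=
      (hR.contDiffAt (n := 2)).isSymmSndFDerivAt (by simp) _ _
    change fderiv ℂ (fderiv ℂ R) P (η, 0) (0, δ) = 0
    have hη' : fderiv ℂ R P (η, 0) = 0 := by rw [hRx]; exact hη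
    have hη2 : η.2 = ∑ k, η.1 k * dZ k ρ Q := by
      rw [prodMk_zero_eq_sum, map_add, map_sum, map_smul, smul_eq_mul] at hη'
      have : ∑ k, fderiv ℂ R P (η.1 k • ((Pi.single k 1, 0), 0)) =
          -(∑ k, η.1 k * dZ k ρ Q) * fderiv ℂ R P ((0, 1), 0) := by
        rw [neg_mul, Finset.sum_mul, ← Finset.sum_neg_distrib]
        refine Finset.sum_congr rfl fun k _ => ?_
        rw [map_smul, smul_eq_mul]
        linear_combination η.1 k * hgP k
      rw [this, ← add_mul, mul_eq_zero, or_iff_left hRw] at hη'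
      linear_combination hη'
    rw [hsym, prodMk_zero_eq_sum, map_add, map_sum, map_smul, hη2, smul_eq_mul, Finset.sum_mul,
      ← Finset.sum_add_distrib]
    refine Finset.sum_eq_zero fun k _ => ?_
    rw [map_smul, smul_eq_mul]
    linear_combination η.1 k * hsec k
  refine ⟨hinj, (LinearMap.injective_iff_surjective_of_finrank_eq_finrank
    (f := (fderiv ℂ (jetMap ρ) Q).toLinearMap) ?_).1 hinj⟩
  simp only [Module.finrank_prod, Module.finrank_fin_fun, Module.finrank_self]
  ring

/-- A Levi nondegenerate hypersurface has a complex defining function `ρ`, on whose graph every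
holomorphic function vanishing on `M` vanishes, and whose jet map is a local biholomorphism. -/
theorem exists_segreFamily {M : Set (CSpace n)} {p : CSpace n} (hLevi : IsLeviNondegenerateAt M p)
    (hw : IsTransverseAt M p) :
    ∃ ρ : (Fin n → ℂ) × CSpace n → ℂ, IsComplexDefiningFunctionAt M p ρ ∧
      (∀ h : CSpace n × CSpace n → ℂ, AnalyticAt ℂ h (p, star p) →
        (∀ᶠ x in 𝓝 p, x ∈ M → h (x, star x) = 0) →
        ∀ᶠ q in 𝓝 (p.1, star p), h ((q.1, ρ q), q.2) = 0) ∧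
      Function.Bijective (fderiv ℂ (jetMap ρ) (p.1, star p)) := by
  obtain ⟨r', hr', hw⟩ := hw
  obtain ⟨r, hr, hlevi⟩ := hLevi
  obtain ⟨ρ, hρ, hv⟩ := exists_complexDefiningFunction hr' hw
  obtain ⟨R, hR, hRr⟩ := exists_complexification hr.analyticAt
  refine ⟨ρ, hρ, hv, bijective_fderiv_jetMap hr.analyticAt hr.regular hlevi hR hRr hρ.analyticAt
    hρ.map_base (hv R hR ?_)⟩
  filter_upwards [hRr, hr.mem_iff] with x h1 h2 h3
  rw [h1, h2.1 h3, Complex.ofReal_zero]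

theorem gradZ_segreGraph {ρ : (Fin n → ℂ) × CSpace n → ℂ} {z : Fin n → ℂ} {ζ : CSpace n}
    (hρ : DifferentiableAt ℂ ρ (z, star ζ)) :
    gradZ (segreGraph ρ ζ) z = fun k => dZ k ρ (z, star ζ) :=
  funext fun _ => pderivZ_slice hρ

/-- The right-hand sides of the associated system, from an inverse `G` of the jet map. -/
def jetSystem (ρ : (Fin n → ℂ) × CSpace n → ℂ)
    (G : CSpace n × (Fin n → ℂ) → (Fin n → ℂ) × CSpace n) (k l : Fin n) :
    CSpace n × (Fin n → ℂ) → ℂ :=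
  fun t => dZ k (dZ l ρ) (G t)

theorem isAssociatedSystemAt_jetSystem {M : Set (CSpace n)} {p : CSpace n}
    {ρ : (Fin n → ℂ) × CSpace n → ℂ} (hρ : IsComplexDefiningFunctionAt M p ρ) {η : Fin n → ℂ}
    (hη : jetMap ρ (p.1, star p) = (p, η))
    {G : CSpace n × (Fin n → ℂ) → (Fin n → ℂ) × CSpace n} (hG : AnalyticAt ℂ G (p, η))
    (hG0 : G (p, η) = (p.1, star p)) (hGJ : ∀ᶠ q in 𝓝 (p.1, star p), G (jetMap ρ q) = q) :
    IsAssociatedSystemAt M p η (jetSystem ρ G) := by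
  refine ⟨ρ, hρ, ?_, fun k l => ?_, ?_⟩
  · rw [gradZ_segreGraph hρ.analyticAt.differentiableAt]
    exact (congrArg Prod.snd hη).symm
  · refine AnalyticAt.fun_comp (g := dZ k (dZ l ρ)) (f := G) ?_ hG
    rw [hG0]
    exact analyticAt_dZ (analyticAt_dZ hρ.analyticAt)
  · have hc : Tendsto (fun q : (Fin n → ℂ) × CSpace n => (q.1, star q.2)) (𝓝 (p.1, p))
        (𝓝 (p.1, star p)) := by
      have : Continuous fun q : (Fin n → ℂ) × CSpace n => (q.1, star q.2) := by fun_prop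
      exact this.tendsto (p.1, p)
    filter_upwards [hc.eventually hGJ, hc.eventually hρ.analyticAt.eventually_analyticAt]
      with q h1 h2 k l
    rw [gradZ_segreGraph h2.differentiableAt]
    refine (pderivZ_pderivZ_slice h2).trans ?_
    change _ = dZ k (dZ l ρ) (G (jetMap ρ (q.1, star q.2)))
    rw [h1]

/-- The associated system is unique. -/
theorem IsAssociatedSystemAt.eventuallyEq_jetSystem {M : Set (CSpace n)} {p : CSpace n}
    {ρ : (Fin n → ℂ) × CSpace n → ℂ}
    (hv : ∀ h : CSpace n × CSpace n → ℂ, AnalyticAt ℂ h (p, star p) →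
        (∀ᶠ x in 𝓝 p, x ∈ M → h (x, star x) = 0) →
        ∀ᶠ q in 𝓝 (p.1, star p), h ((q.1, ρ q), q.2) = 0) {η : Fin n → ℂ}
    (hη : jetMap ρ (p.1, star p) = (p, η))
    {G : CSpace n × (Fin n → ℂ) → (Fin n → ℂ) × CSpace n} (hG : AnalyticAt ℂ G (p, η))
    (hG0 : G (p, η) = (p.1, star p)) (hJG : ∀ᶠ t in 𝓝 (p, η), jetMap ρ (G t) = t)
    {η' : Fin n → ℂ} {Φ : Fin n → Fin n → CSpace n × (Fin n → ℂ) → ℂ}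
    (hΦ : IsAssociatedSystemAt M p η' Φ) :
    η' = η ∧ ∀ k l, Φ k l =ᶠ[𝓝 (p, η)] jetSystem ρ G k l := by
  obtain ⟨ρ', hρ', hη', -, hsys⟩ := hΦ
  have heq : ρ' =ᶠ[𝓝 (p.1, star p)] ρ := by
    have := hv (fun q => ρ' (q.1.1, q.2) - q.1.2)
      ((AnalyticAt.fun_comp (f := fun q : CSpace n × CSpace n => (q.1.1, q.2)) hρ'.analyticAt
        ((analyticAt_fst.fun_comp analyticAt_fst).prod analyticAt_snd)).sub
          (analyticAt_snd.fun_comp analyticAt_fst))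
      (by
        filter_upwards [hρ'.mem_iff] with x hx hxM
        rw [hx.1 hxM]
        exact sub_eq_zero.2 (by rw [← hx.1 hxM]))
    filter_upwards [this] with q hq
    exact sub_eq_zero.1 hq
  have hηη : η' = η := by
    rw [hη', gradZ_segreGraph hρ'.analyticAt.differentiableAt]
    refine Eq.trans ?_ (congrArg Prod.snd hη)
    funext k
    exact (dZ_congr heq).self_of_nhds
  refine ⟨hηη, fun k l => ?_⟩
  have hGt : Tendsto G (𝓝 (p, η)) (𝓝 (p.1, star p)) := by
    have := hG.continuousAt.tendsto
    rwa [hG0] at this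
  have hc : Tendsto (fun t => ((G t).1, star (G t).2)) (𝓝 (p, η)) (𝓝 (p.1, p)) := by
    have : Continuous fun q : (Fin n → ℂ) × CSpace n => (q.1, star q.2) := by fun_prop
    have h := (this.tendsto (p.1, star p)).comp hGt
    simpa [Function.comp_def] using h
  filter_upwards [hc.eventually hsys, hGt.eventually hρ'.analyticAt.eventually_analyticAt,
    hGt.eventually heq.eventually_nhds, hJG] with t h1 h2 h3 h4
  have h5 := h1 k l
  have h6 : ((G t).1, star (star (G t).2)) = G t := by rw [star_star]
  have h7 : AnalyticAt ℂ ρ' ((G t).1, star (star (G t).2)) := by rwa [h6]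
  rw [gradZ_segreGraph h7.differentiableAt] at h5
  have h8 := (pderivZ_pderivZ_slice (k := k) (l := l) h7).symm.trans h5
  simp only [segreGraph, h6] at h8
  have h9 : jetMap ρ' (G t) = t := by
    rw [← h4, h4]
    conv_rhs => rw [← h4]
    simp only [jetMap]
    rw [h3.self_of_nhds]
    congr 1
    funext j
    exact (dZ_congr h3).self_of_nhds
  change Φ k l t = dZ k (dZ l ρ) (G t)
  rw [← (dZ_congr (dZ_congr h3)).self_of_nhds, h8]
  change _ = Φ k l (jetMap ρ' (G t))
  rw [h9]

/-! ### Germs of analytic functions -/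

section Germs

variable {E : Type*} [NormedAddCommGroup E] [NormedSpace ℂ E]

/-- The ring of germs of analytic functions. -/
def analyticGerms (x : E) : Subring (Germ (𝓝 x) ℂ) where
  carrier := {g | ∃ f : E → ℂ, AnalyticAt ℂ f x ∧ g = f}
  mul_mem' := by
    rintro _ _ ⟨f, hf, rfl⟩ ⟨g, hg, rfl⟩
    exact ⟨f * g, hf.mul hg, rfl⟩
  one_mem' := ⟨1, analyticAt_const, rfl⟩
  add_mem' := by
    rintro _ _ ⟨f, hf, rfl⟩ ⟨g, hg, rfl⟩
    exact ⟨f + g, hf.add hg, rfl⟩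
  zero_mem' := ⟨0, analyticAt_const, rfl⟩
  neg_mem' := by
    rintro _ ⟨f, hf, rfl⟩
    exact ⟨-f, hf.neg, rfl⟩

theorem eventually_eq_zero_or_of_mul {f g : E → ℂ} {x : E} (hf : AnalyticAt ℂ f x)
    (hg : AnalyticAt ℂ g x) (h : ∀ᶠ y in 𝓝 x, f y * g y = 0) :
    (∀ᶠ y in 𝓝 x, f y = 0) ∨ ∀ᶠ y in 𝓝 x, g y = 0 := by
  obtain ⟨ε, hε, hball⟩ := Metric.eventually_nhds_iff_ball.1
    (hf.eventually_analyticAt.and (hg.eventually_analyticAt.and h))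
  by_cases hc : ∃ y ∈ Metric.ball x ε, f y ≠ 0
  · right
    obtain ⟨y, hy, hfy⟩ := hc
    have hz : g =ᶠ[𝓝 y] 0 := by
      filter_upwards [(hball y hy).1.continuousAt.eventually_ne hfy,
        Metric.isOpen_ball.mem_nhds hy] with z h1 h2
      exact (mul_eq_zero.1 (hball z h2).2.2).resolve_left h1
    have := AnalyticOnNhd.eqOn_zero_of_preconnected_of_eventuallyEq_zero
      (fun z hz => (hball z hz).2.1) (convex_ball x ε).isPreconnected hy hz
    filter_upwards [Metric.ball_mem_nhds x hε] with z hz using this hz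
  · left
    push Not at hc
    filter_upwards [Metric.ball_mem_nhds x hε] with z hz using hc z hz

instance (x : E) : IsDomain (analyticGerms x) := by
  have : NoZeroDivisors (analyticGerms x) := by
    refine ⟨?_⟩
    rintro ⟨_, f, hf, rfl⟩ ⟨_, g, hg, rfl⟩ h
    have h' : ((f * g : E → ℂ) : Germ (𝓝 x) ℂ) = ((0 : E → ℂ) : Germ (𝓝 x) ℂ) :=
      congrArg Subtype.val h
    rcases eventually_eq_zero_or_of_mul hf hg (Germ.coe_eq.1 h') with h | h
    · exact Or.inl (Subtype.ext (Germ.coe_eq.2 h))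
    · exact Or.inr (Subtype.ext (Germ.coe_eq.2 h))
  have : Nontrivial (analyticGerms x) := inferInstance
  exact NoZeroDivisors.to_isDomain _

end Germs

section Degree

variable {G : Type*} [CommRing G]

theorem degreeOver_lt_top_iff (A : Subring G) (f : G) : degreeOver A f < ⊤ ↔ IsAlgebraic A f := by
  simp only [degreeOver, iInf_lt_iff, IsAlgebraic]
  constructor
  · rintro ⟨P, h1, h2, -⟩
    exact ⟨P, h1, h2⟩
  · rintro ⟨P, h1, h2⟩
    exact ⟨P, h1, h2, ENat.natCast_lt_top _⟩

theorem degreeOver_ne_zero (A : Subring G) (f : G) : degreeOver A f ≠ 0 := by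
  have : 1 ≤ degreeOver A f := by
    refine le_iInf fun P => le_iInf fun h1 => le_iInf fun h2 => ?_
    by_contra hc
    have h0 : P.natDegree = 0 := by
      by_contra h
      exact hc (by exact_mod_cast Nat.one_le_iff_ne_zero.2 h)
    rw [eq_C_of_natDegree_eq_zero h0] at h1 h2
    rw [aeval_C] at h2
    exact h1 (by rw [Subtype.ext (a1 := P.coeff 0) (a2 := 0) h2, C_0])
  intro h
  rw [h] at this
  simp at this

theorem enat_prod_lt_top_iff {ι : Type*} (s : Finset ι) (f : ι → ℕ∞) (h : ∀ i, f i ≠ 0) :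
    ∏ i ∈ s, f i < ⊤ ↔ ∀ i ∈ s, f i < ⊤ := by
  classical
  induction s using Finset.induction_on with
  | empty => simp
  | insert a s ha ih =>
    rw [Finset.prod_insert ha, Finset.forall_mem_insert, ← ih]
    have h0 : ∏ i ∈ s, f i ≠ 0 := Finset.prod_ne_zero_iff.2 fun i _ => h i
    have h1 := h a
    constructor
    · intro hlt
      refine ⟨lt_top_iff_ne_top.2 fun ht => ?_, lt_top_iff_ne_top.2 fun ht => ?_⟩
      · rw [ht, ENat.top_mul h0] at hlt
        exact lt_irrefl _ hlt
      · rw [ht, ENat.mul_top h1] at hlt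
        exact lt_irrefl _ hlt
    · exact fun ⟨h2, h3⟩ => WithTop.mul_lt_top h2 h3

theorem isAlgebraic_subring_mono {A B : Subring G} (h : A ≤ B) {a : G} (ha : IsAlgebraic A a) :
    IsAlgebraic B a := by
  let _ : Algebra A B := (Subring.inclusion h).toAlgebra
  have : IsScalarTower A B G := .of_algebraMap_eq fun _ => rfl
  exact ha.extendScalars (Subring.inclusion_injective h)

theorem isAlgebraic_subring_trans {A B : Subring G} (h : A ≤ B) [IsDomain B]
    (hB : ∀ b ∈ B, IsAlgebraic A b) {a : G} (ha : IsAlgebraic B a) : IsAlgebraic A a := by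
  let _ : Algebra A B := (Subring.inclusion h).toAlgebra
  have : IsScalarTower A B G := .of_algebraMap_eq fun _ => rfl
  have : Algebra.IsAlgebraic A B :=
    ⟨fun b => (isAlgebraic_algebraMap_iff (A := G) Subtype.val_injective).1 (hB b b.2)⟩
  exact ha.restrictScalars _

theorem isAlgebraic_of_mem_closure {A : Subring G} [IsDomain A] {S : Set G}
    (hS : ∀ s ∈ S, IsAlgebraic A s) {a : G} (ha : a ∈ Subring.closure S) : IsAlgebraic A a := by
  have : Subring.closure S ≤ (Subalgebra.algebraicClosure A G).toSubring :=
    Subring.closure_le.2 hS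
  exact this ha

theorem isDomain_of_le {A B : Subring G} (h : A ≤ B) [IsDomain B] : IsDomain A :=
  (Subring.inclusion_injective h).isDomain _

theorem prod_degreeOver_lt_top_iff {ι : Type*} [Fintype ι] [LinearOrder ι] (O : Subring G)
    [IsDomain O] (S : Set G) (hS : S ⊆ O) (F : ι → G) (hF : ∀ i, F i ∈ O) :
    ∏ i, degreeOver (Subring.closure (S ∪ {g | ∃ j < i, g = F j})) (F i) < ⊤ ↔
      ∀ i, IsAlgebraic (Subring.closure S) (F i) := by
  rw [enat_prod_lt_top_iff _ _ fun i => degreeOver_ne_zero _ _]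
  simp only [Finset.mem_univ, true_implies, degreeOver_lt_top_iff]
  refine ⟨fun h i => ?_, fun h i => isAlgebraic_subring_mono
    (Subring.closure_mono Set.subset_union_left) (h i)⟩
  induction i using WellFoundedLT.induction with
  | ind i ih =>
    have hle : Subring.closure (S ∪ {g | ∃ j < i, g = F j}) ≤ O := by
      rw [Subring.closure_le]
      rintro x (hx | ⟨j, -, rfl⟩)
      exacts [hS hx, hF j]
    have := isDomain_of_le hle
    have hle' : Subring.closure S ≤ Subring.closure (S ∪ {g | ∃ j < i, g = F j}) :=
      Subring.closure_mono Set.subset_union_left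
    have := isDomain_of_le hle'
    refine isAlgebraic_subring_trans hle' (fun b hb => isAlgebraic_of_mem_closure ?_ hb) (h i)
    rintro x (hx | ⟨j, hj, rfl⟩)
    · exact isAlgebraic_algebraMap (⟨x, Subring.subset_closure hx⟩ : Subring.closure S)
    · exact ih j hj

/-- If `n` algebraically independent elements are algebraic over the ring generated by `n + 1`
algebraically dependent ones, then these are in turn algebraic over the ring generated by the
former. -/
theorem isAlgebraic_adjoin_of_exchange {R A ι κ : Type*} [CommRing R] [Nontrivial R] [CommRing A]
    [IsDomain A] [Algebra R A] [FaithfulSMul R A] [Fintype ι] [Fintype κ]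
    (hcard : Fintype.card κ ≤ Fintype.card ι + 1) {y : ι → A} {c : κ → A}
    (hy : AlgebraicIndependent R y) (hc : ¬ AlgebraicIndependent R c)
    (hyc : ∀ i, IsAlgebraic (Algebra.adjoin R (Set.range c)) (y i)) (j : κ) :
    IsAlgebraic (Algebra.adjoin R (Set.range y)) (c j) := by
  let m := AlgebraicIndependent.matroid R A
  have hyI : m.Indep (Set.range y) := hy.coe_range
  have hycard : (Set.range y).encard = Fintype.card ι := by
    rw [← Set.image_univ, hy.injective.encard_image, Set.encard_univ, ENat.card_eq_coe_fintype_card]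
  have hsub : Set.range y ⊆ m.closure (Set.range c) := by
    rw [AlgebraicIndependent.matroid_closure_eq]
    rintro _ ⟨i, rfl⟩
    exact hyc i
  have hfin : (Set.range c).Finite := Set.finite_range c
  have hcle : (Set.range c).encard ≤ Fintype.card ι + 1 := by
    rw [← Set.image_univ]
    refine (Set.encard_image_le _ _).trans ?_
    rw [Set.encard_univ, ENat.card_eq_coe_fintype_card]
    exact_mod_cast hcard
  have hrk : m.eRk (Set.range c) ≤ Fintype.card ι := by
    have hlt : m.eRk (Set.range c) < Fintype.card ι + 1 := by
      by_cases hinj : Function.Injective c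
      · refine lt_of_lt_of_le (m.eRk_lt_encard_of_dep_of_finite hfin ⟨fun h => hc ?_, ?_⟩) hcle
        · exact (algebraicIndependent_subtype_range hinj).1 h
        · exact Set.subset_univ _
      · refine (m.eRk_le_encard _).trans_lt ?_
        have : (Set.range c).encard < Fintype.card κ := by
          classical
          have hr : Set.range c = (Finset.univ.image c : Finset A) := by simp
          rw [hr, Set.encard_coe_eq_coe_finsetCard]
          have h1 := Finset.card_image_le (s := Finset.univ) (f := c)
          have h2 : (Finset.univ.image c).card ≠ (Finset.univ : Finset κ).card := fun h =>
            hinj fun a b hab => Finset.card_image_iff.1 h (by simp) (by simp) hab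
          exact_mod_cast lt_of_le_of_ne h1 h2
        exact this.trans_le (by exact_mod_cast hcard)
    exact Order.lt_add_one_iff_of_not_isMax (by simp) |>.1 hlt
  have hb := hyI.isBasis_of_eRk_ge (Set.finite_range y) hsub
    (by rw [m.eRk_closure_eq, hyI.eRk_eq_encard, hycard]; exact hrk)
  have : c j ∈ m.closure (Set.range y) := by
    rw [hb.closure_eq_closure, m.closure_closure]
    exact m.subset_closure _ (Set.subset_univ _) ⟨j, rfl⟩
  rw [AlgebraicIndependent.matroid_closure_eq] at this
  exact this

end Degree

section Germs

variable {E : Type*} [NormedAddCommGroup E] [NormedSpace ℂ E] {m : ℕ}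

theorem pseudoPolyGens_subset_analyticGerms (x₀ : E) (y₀ : Fin m → ℂ) :
    pseudoPolyGens x₀ y₀ ⊆ analyticGerms (x₀, y₀) := by
  rintro _ (⟨c, hc, rfl⟩ | ⟨j, rfl⟩)
  · exact ⟨_, AnalyticAt.fun_comp (f := fun q : E × (Fin m → ℂ) => q.1) hc analyticAt_fst, rfl⟩
  · exact ⟨_, ((ContinuousLinearMap.proj (R := ℂ) (φ := fun _ : Fin m => ℂ) j).analyticAt
      _).fun_comp analyticAt_snd, rfl⟩

/-- The transcendence degree is finite if and only if all components are algebraic. -/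
theorem transcendenceDegree_lt_top_iff {ι : Type*} [Fintype ι] [LinearOrder ι] {x₀ : E}
    {y₀ : Fin m → ℂ} {F : ι → E × (Fin m → ℂ) → ℂ} (hF : ∀ i, AnalyticAt ℂ (F i) (x₀, y₀)) :
    transcendenceDegree x₀ y₀ F < ⊤ ↔ ∀ i, IsAlgebraicInSecond x₀ y₀ (F i) :=
  prod_degreeOver_lt_top_iff (analyticGerms (x₀, y₀)) _ (pseudoPolyGens_subset_analyticGerms x₀ y₀)
    (fun i => (F i : Germ (𝓝 (x₀, y₀)) ℂ)) fun i => ⟨F i, hF i, rfl⟩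

theorem IsAlgebraicInSecond.congr {x₀ : E} {y₀ : Fin m → ℂ} {f g : E × (Fin m → ℂ) → ℂ}
    (hf : IsAlgebraicInSecond x₀ y₀ f) (h : f =ᶠ[𝓝 (x₀, y₀)] g) : IsAlgebraicInSecond x₀ y₀ g := by
  rw [IsAlgebraicInSecond, ← Germ.coe_eq.2 h]
  exact hf

end Germs

section Conjugation

variable {E F : Type*} [NormedAddCommGroup E] [NormedSpace ℂ E] [StarAddMonoid E]
  [NormedStarGroup E] [StarModule ℂ E] [NormedAddCommGroup F] [NormedSpace ℂ F] [StarAddMonoid F]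
  [NormedStarGroup F] [StarModule ℂ F]

/-- The power series with conjugate coefficients. -/
def conjSeries (P : FormalMultilinearSeries ℂ E F) : FormalMultilinearSeries ℂ E F := fun k =>
  MultilinearMap.mkContinuous
    { toFun := fun v => star (P k fun j => star (v j))
      map_update_add' := fun v i x y => by
        have h (x : E) : (fun j => star (Function.update v i x j)) =
            Function.update (fun j => star (v j)) i (star x) :=
          funext fun j => Function.apply_update (fun _ => star) v i x j
        rw [h, h, h, star_add, (P k).map_update_add, star_add]
      map_update_smul' := fun v i c x => by
        have h (x : E) : (fun j => star (Function.update v i x j)) =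
            Function.update (fun j => star (v j)) i (star x) :=
          funext fun j => Function.apply_update (fun _ => star) v i x j
        rw [h, h, star_smul, (P k).map_update_smul, star_smul, star_star] }
    ‖P k‖ fun v => by
      change ‖star (P k fun j => star (v j))‖ ≤ _
      rw [norm_star]
      simpa using (P k).le_opNorm fun j => star (v j)

/-- `z ↦ conj (f (conj z))` is holomorphic if `f` is. -/
theorem analyticAt_star_star {f : E → F} {p : E} (hf : AnalyticAt ℂ f p) :
    AnalyticAt ℂ (fun z => star (f (star z))) (star p) := by
  obtain ⟨P, r, h⟩ := hf
  refine ⟨conjSeries P, r, ?_, h.r_pos, fun {y} hy => ?_⟩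
  · exact h.r_le.trans (FormalMultilinearSeries.radius_le_of_le fun {k} =>
      MultilinearMap.mkContinuous_norm_le _ (norm_nonneg _) _)
  · have hy' : star y ∈ Metric.eball (0 : E) r := by
      rw [Metric.mem_eball, edist_zero_right] at hy ⊢
      simpa [enorm_eq_nnnorm] using hy
    have := (h.hasSum hy').star
    rw [star_add, star_star]
    exact this

end Conjugation

section Polynomials

theorem mvPolynomial_eq_zero_of_eventually {σ : Type*} [Finite σ] {Q : MvPolynomial σ ℂ}
    {v : σ → ℂ} (h : ∀ᶠ u in 𝓝 v, MvPolynomial.eval u Q = 0) : Q = 0 := by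
  have := Fintype.ofFinite σ
  obtain ⟨ε, hε, hb⟩ := Metric.eventually_nhds_iff_ball.1 h
  refine MvPolynomial.funext_set (fun i => Metric.ball (v i) ε)
    (fun i => infinite_of_mem_nhds (v i) (Metric.ball_mem_nhds _ hε)) fun x hx => ?_
  rw [map_zero]
  refine hb x ?_
  rw [ball_pi _ hε]
  exact hx

theorem hasFDerivAt_mvPolynomial_eval {σ : Type*} [Fintype σ] (Q : MvPolynomial σ ℂ)
    (v : σ → ℂ) :
    HasFDerivAt (fun u : σ → ℂ => MvPolynomial.eval u Q)
      (∑ j, MvPolynomial.eval v (MvPolynomial.pderiv j Q) •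
        (ContinuousLinearMap.proj j : (σ → ℂ) →L[ℂ] ℂ)) v := by
  classical
  induction Q using MvPolynomial.induction_on with
  | C a =>
    simp only [MvPolynomial.eval_C]
    refine (hasFDerivAt_const a v).congr_fderiv (ContinuousLinearMap.ext fun w => ?_)
    simp [_root_.sum_apply]
  | add P Q hP hQ =>
    simp only [map_add]
    refine (hP.add hQ).congr_fderiv (ContinuousLinearMap.ext fun w => ?_)
    simp [_root_.sum_apply, add_mul, Finset.sum_add_distrib]
  | mul_X P i hP =>
    simp only [map_mul, MvPolynomial.eval_X]
    refine (hP.mul (hasFDerivAt_apply i v)).congr_fderiv (ContinuousLinearMap.ext fun w => ?_)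
    have h (j : σ) : MvPolynomial.eval v (MvPolynomial.pderiv j (P * MvPolynomial.X i)) * w j =
        (if j = i then MvPolynomial.eval v P * w j else 0) +
          v i * (MvPolynomial.eval v (MvPolynomial.pderiv j P) * w j) := by
      rw [MvPolynomial.pderiv_mul, MvPolynomial.pderiv_X]
      rcases eq_or_ne j i with rfl | hne
      · simp; ring
      · simp [hne, hne.symm]; ring
    simp only [_root_.add_apply, _root_.sum_apply, _root_.smul_apply,
      ContinuousLinearMap.proj_apply, smul_eq_mul, h, Finset.sum_add_distrib, Finset.mul_sum]
    simp

theorem totalDegree_pderiv_lt {σ R : Type*} [CommSemiring R] {Q : MvPolynomial σ R} {i : σ}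
    (h : MvPolynomial.pderiv i Q ≠ 0) :
    (MvPolynomial.pderiv i Q).totalDegree < Q.totalDegree := by
  classical
  obtain ⟨m, hm, hd⟩ := Finset.exists_mem_eq_sup _ (MvPolynomial.support_nonempty.2 h)
    fun s : σ →₀ ℕ => s.sum fun _ e => e
  have hc : Q.coeff (m + Finsupp.single i 1) ≠ 0 := by
    intro h0
    rw [MvPolynomial.mem_support_iff, MvPolynomial.coeff_pderiv, h0] at hm
    simp at hm
  have hle := MvPolynomial.le_totalDegree (MvPolynomial.mem_support_iff.2 hc)
  rw [Finsupp.sum_add_index' (fun _ => rfl) (fun _ _ _ => rfl), Finsupp.sum_single_index rfl] at hle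
  rw [MvPolynomial.totalDegree, hd]
  exact hle

/-- The complex coordinates `(z, w)` as a vector. -/
def coords (n : ℕ) : CSpace n →L[ℂ] (Fin n ⊕ Unit → ℂ) :=
  ContinuousLinearMap.pi (Sum.elim
    (fun j => (ContinuousLinearMap.proj j).comp (ContinuousLinearMap.fst ℂ _ _))
    (fun _ => ContinuousLinearMap.snd ℂ _ _))

/-- The inverse of `coords`. -/
def ofCoords (n : ℕ) : (Fin n ⊕ Unit → ℂ) →L[ℂ] CSpace n :=
  (ContinuousLinearMap.pi fun j => ContinuousLinearMap.proj (Sum.inl j)).prod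
    (ContinuousLinearMap.proj (Sum.inr ()))

@[simp] theorem coords_inl (x : CSpace n) (j : Fin n) : coords n x (Sum.inl j) = x.1 j := rfl

@[simp] theorem coords_inr (x : CSpace n) (u : Unit) : coords n x (Sum.inr u) = x.2 := rfl

@[simp] theorem coords_ofCoords (v : Fin n ⊕ Unit → ℂ) : coords n (ofCoords n v) = v := by
  ext (j | j) <;> rfl

@[simp] theorem ofCoords_coords (x : CSpace n) : ofCoords n (coords n x) = x := rfl

/-- A polynomial in `(X, c)` evaluated at a pair of points of `ℂⁿ⁺¹`. -/
def evalPair (Q : MvPolynomial ((Fin n ⊕ Unit) ⊕ (Fin n ⊕ Unit)) ℂ) (x c : CSpace n) : ℂ :=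
  MvPolynomial.eval (Sum.elim (coords n x) (coords n c)) Q

/-- A real polynomial in the real coordinates is a complex polynomial in `x` and `conj x`. -/
theorem exists_polarization {P : MvPolynomial (Fin n ⊕ Fin n ⊕ Fin 2) ℝ} (hP : P ≠ 0) :
    ∃ Q : MvPolynomial ((Fin n ⊕ Unit) ⊕ (Fin n ⊕ Unit)) ℂ, Q ≠ 0 ∧
      ∀ x : CSpace n, evalPair Q x (star x) = (MvPolynomial.eval (realCoords x) P : ℝ) := by
  let re (i : Fin n ⊕ Unit) : MvPolynomial ((Fin n ⊕ Unit) ⊕ (Fin n ⊕ Unit)) ℂ :=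
    MvPolynomial.C 2⁻¹ * (MvPolynomial.X (Sum.inl i) + MvPolynomial.X (Sum.inr i))
  let im (i : Fin n ⊕ Unit) : MvPolynomial ((Fin n ⊕ Unit) ⊕ (Fin n ⊕ Unit)) ℂ :=
    MvPolynomial.C (-Complex.I / 2) * (MvPolynomial.X (Sum.inl i) - MvPolynomial.X (Sum.inr i))
  let g : Fin n ⊕ Fin n ⊕ Fin 2 → MvPolynomial ((Fin n ⊕ Unit) ⊕ (Fin n ⊕ Unit)) ℂ :=
    Sum.elim (fun j => re (Sum.inl j))
      (Sum.elim (fun j => im (Sum.inl j)) ![re (Sum.inr ()), im (Sum.inr ())])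
  have hg (x : CSpace n) (i) :
      MvPolynomial.eval (Sum.elim (coords n x) (coords n (star x))) (g i) =
        (realCoords x i : ℂ) := by
    have h1 (z : ℂ) : 2⁻¹ * (z + star z) = (z.re : ℂ) := by
      apply Complex.ext <;> simp
      ring
    have h2 (z : ℂ) : -Complex.I / 2 * (z - star z) = (z.im : ℂ) := by
      apply Complex.ext <;> simp
      ring
    rcases i with j | j | j
    · simpa [g, re, realCoords] using h1 (x.1 j)
    · simpa [g, im, realCoords] using h2 (x.1 j)
    · fin_cases j
      · simpa [g, re, realCoords] using h1 x.2
      · simpa [g, im, realCoords] using h2 x.2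
  have hQ (P) (x : CSpace n) : evalPair (MvPolynomial.bind₁ g (MvPolynomial.map Complex.ofRealHom P))
      x (star x) = (MvPolynomial.eval (realCoords x) P : ℝ) := by
    rw [evalPair]
    induction P using MvPolynomial.induction_on with
    | C a => simp
    | add P Q hP hQ => simp only [map_add, hP, hQ, Complex.ofReal_add]
    | mul_X P i hP =>
      simp only [map_mul, hP, MvPolynomial.map_X, MvPolynomial.bind₁_X_right, hg,
        MvPolynomial.eval_X, Complex.ofReal_mul]
  refine ⟨_, fun h0 => hP ?_, hQ P⟩
  refine MvPolynomial.funext fun v => ?_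
  let x : CSpace n := (fun j => ⟨v (Sum.inl j), v (Sum.inr (Sum.inl j))⟩,
    ⟨v (Sum.inr (Sum.inr 0)), v (Sum.inr (Sum.inr 1))⟩)
  have hx : realCoords x = v := by
    ext (j | j | j)
    · rfl
    · rfl
    · fin_cases j <;> rfl
  have := hQ P x
  rw [h0, hx, evalPair, map_zero] at this
  rw [map_zero]
  exact_mod_cast this.symm

end Polynomials

section PolyInParameter

/-- Functions of `(x, χ)` that are polynomial in given functions `cⱼ(χ)`, with coefficients
holomorphic in `x` near `p`. -/
inductive IsPolyInParameter {κ : Type*} (p : CSpace n) (c : κ → CSpace n → ℂ) :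
    (CSpace n × CSpace n → ℂ) → Prop
  | coeff (a : CSpace n → ℂ) (ha : AnalyticAt ℂ a p) : IsPolyInParameter p c fun q => a q.1
  | var (j : κ) : IsPolyInParameter p c fun q => c j q.2
  | add {f g : CSpace n × CSpace n → ℂ} (hf : IsPolyInParameter p c f)
      (hg : IsPolyInParameter p c g) : IsPolyInParameter p c fun q => f q + g q
  | mul {f g : CSpace n × CSpace n → ℂ} (hf : IsPolyInParameter p c f)
      (hg : IsPolyInParameter p c g) : IsPolyInParameter p c fun q => f q * g q

variable {κ : Type*} {p : CSpace n} {c : κ → CSpace n → ℂ} {f : CSpace n × CSpace n → ℂ}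

theorem IsPolyInParameter.analyticAt (hf : IsPolyInParameter p c f) {χ : CSpace n}
    (hc : ∀ j, AnalyticAt ℂ (c j) χ) : AnalyticAt ℂ f (p, χ) := by
  induction hf with
  | coeff a ha => exact AnalyticAt.fun_comp (f := fun q : CSpace n × CSpace n => q.1) ha analyticAt_fst
  | var j => exact AnalyticAt.fun_comp (f := fun q : CSpace n × CSpace n => q.2) (hc j) analyticAt_snd
  | add _ _ hf hg => exact hf.add hg
  | mul _ _ hf hg => exact hf.mul hg

/-- The class is stable under differentiation in `x`. -/
theorem IsPolyInParameter.exists_fderiv (hf : IsPolyInParameter p c f) {χ : CSpace n}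
    (hc : ∀ j, AnalyticAt ℂ (c j) χ) (v : CSpace n) :
    ∃ g, IsPolyInParameter p c g ∧ ∀ᶠ q in 𝓝 (p, χ), fderiv ℂ f q (v, 0) = g q := by
  induction hf with
  | coeff a ha =>
    refine ⟨_, .coeff (fun x => fderiv ℂ a x v)
      (((ContinuousLinearMap.apply ℂ ℂ v).analyticAt _).fun_comp ha.fderiv), ?_⟩
    filter_upwards [continuousAt_fst.eventually ha.eventually_analyticAt] with q hq
    have h : HasFDerivAt (fun q : CSpace n × CSpace n => a q.1) _ q :=
      hq.differentiableAt.hasFDerivAt.comp q hasFDerivAt_fst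
    rw [h.fderiv]
    rfl
  | var j =>
    refine ⟨_, .coeff (fun _ => 0) analyticAt_const, ?_⟩
    filter_upwards [continuousAt_snd.eventually (hc j).eventually_analyticAt] with q hq
    have h : HasFDerivAt (fun q : CSpace n × CSpace n => c j q.2) _ q :=
      hq.differentiableAt.hasFDerivAt.comp q hasFDerivAt_snd
    rw [h.fderiv]
    simp
  | @add f g hf hg ihf ihg =>
    obtain ⟨f', hf', hff'⟩ := ihf
    obtain ⟨g', hg', hgg'⟩ := ihg
    refine ⟨_, hf'.add hg', ?_⟩
    filter_upwards [hff', hgg', (hf.analyticAt hc).eventually_analyticAt,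
      (hg.analyticAt hc).eventually_analyticAt] with q h1 h2 h3 h4
    rw [fderiv_fun_add h3.differentiableAt h4.differentiableAt, ← h1, ← h2]
    rfl
  | @mul f g hf hg ihf ihg =>
    obtain ⟨f', hf', hff'⟩ := ihf
    obtain ⟨g', hg', hgg'⟩ := ihg
    refine ⟨_, (hf.mul hg').add (hg.mul hf'), ?_⟩
    filter_upwards [hff', hgg', (hf.analyticAt hc).eventually_analyticAt,
      (hg.analyticAt hc).eventually_analyticAt] with q h1 h2 h3 h4
    rw [fderiv_fun_mul h3.differentiableAt h4.differentiableAt, ← h1, ← h2]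
    rfl

theorem isPolyInParameter_evalPair {H K : CSpace n → CSpace n} (hH : AnalyticAt ℂ H p)
    (Q : MvPolynomial ((Fin n ⊕ Unit) ⊕ (Fin n ⊕ Unit)) ℂ) :
    IsPolyInParameter p (fun j χ => coords n (K χ) j) (fun q => evalPair Q (H q.1) (K q.2)) := by
  induction Q using MvPolynomial.induction_on with
  | C a => simpa [evalPair] using IsPolyInParameter.coeff (fun _ => a) analyticAt_const
  | add P Q hP hQ => simpa [evalPair] using hP.add hQ
  | mul_X P i hP =>
    rcases i with i | i
    · have hi : AnalyticAt ℂ (fun x => coords n (H x) i) p :=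
        (((ContinuousLinearMap.proj (R := ℂ) (φ := fun _ : Fin n ⊕ Unit => ℂ) i).comp
          (coords n)).analyticAt _).fun_comp hH
      simpa [evalPair] using hP.mul (.coeff _ hi)
    · simpa [evalPair] using hP.mul (.var i)

end PolyInParameter

theorem hasFDerivAt_evalPair (Q : MvPolynomial ((Fin n ⊕ Unit) ⊕ (Fin n ⊕ Unit)) ℂ)
    (x c : CSpace n) :
    HasFDerivAt (fun x => evalPair Q x c)
      (∑ j, evalPair (MvPolynomial.pderiv (Sum.inl j) Q) x c •
        ((ContinuousLinearMap.proj j).comp (coords n))) x := by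
  have h1 : HasFDerivAt
      (fun x : CSpace n => (Sum.elim (coords n x) (coords n c) : (Fin n ⊕ Unit) ⊕ (Fin n ⊕ Unit) → ℂ))
      (ContinuousLinearMap.pi (Sum.elim (fun j => (ContinuousLinearMap.proj j).comp (coords n))
        fun _ => 0)) x := by
    refine hasFDerivAt_pi.2 ?_
    rintro (j | j)
    · exact ((ContinuousLinearMap.proj j).comp (coords n)).hasFDerivAt
    · exact hasFDerivAt_const _ _
  have h2 : HasFDerivAt (fun x => evalPair Q x c) _ x :=
    (hasFDerivAt_mvPolynomial_eval Q _).comp x h1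
  refine h2.congr_fderiv (ContinuousLinearMap.ext fun v => ?_)
  simp [_root_.sum_apply, evalPair]

theorem eventually_of_eventually_comp {E F : Type*} [NormedAddCommGroup E]
    [NormedSpace ℂ E] [NormedAddCommGroup F] [NormedSpace ℂ F] [FiniteDimensional ℂ E]
    [FiniteDimensional ℂ F] {f : E → F} {a : E} (hf : AnalyticAt ℂ f a)
    (hb : Function.Bijective (fderiv ℂ f a)) {T : F → Prop} (h : ∀ᶠ x in 𝓝 a, T (f x)) :
    ∀ᶠ y in 𝓝 (f a), T y := by
  obtain ⟨g, hg, hga, hfg, -⟩ := exists_analytic_local_inverse hf hb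
  have := hg.continuousAt.tendsto
  rw [hga] at this
  filter_upwards [this.eventually h, hfg] with y h1 h2
  rwa [h2] at h1

theorem eventually_surjective_fderiv {E F : Type*} [NormedAddCommGroup E]
    [NormedSpace ℂ E] [NormedAddCommGroup F] [NormedSpace ℂ F] [FiniteDimensional ℂ E]
    [FiniteDimensional ℂ F] {f : E → F} {a : E} (hf : AnalyticAt ℂ f a)
    (hb : Function.Bijective (fderiv ℂ f a)) :
    ∀ᶠ x in 𝓝 a, Function.Surjective (fderiv ℂ f x) := by
  have := FiniteDimensional.complete ℂ E
  have := FiniteDimensional.complete ℂ F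
  let e : E ≃L[ℂ] F :=
    (LinearEquiv.ofBijective (fderiv ℂ f a : E →ₗ[ℂ] F) hb).toContinuousLinearEquiv
  have he : (e : E →L[ℂ] F) = fderiv ℂ f a := by ext; rfl
  have hn := e.nhds
  rw [he] at hn
  filter_upwards [hf.fderiv.continuousAt.eventually hn] with x ⟨e', he'⟩
  rw [← he']
  exact e'.surjective

theorem fderiv_evalPair_comp {H K : CSpace n → CSpace n}
    {Q : MvPolynomial ((Fin n ⊕ Unit) ⊕ (Fin n ⊕ Unit)) ℂ} {s : CSpace n × CSpace n}
    (hH : DifferentiableAt ℂ H s.1)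
    (hS : DifferentiableAt ℂ (fun s : CSpace n × CSpace n => evalPair Q (H s.1) (K s.2)) s)
    (v : CSpace n) :
    fderiv ℂ (fun s : CSpace n × CSpace n => evalPair Q (H s.1) (K s.2)) s (v, 0) =
      ∑ j, evalPair (MvPolynomial.pderiv (Sum.inl j) Q) (H s.1) (K s.2) *
        coords n (fderiv ℂ H s.1 v) j := by
  have h1 : HasFDerivAt (fun x => evalPair Q (H x) (K s.2)) _ s.1 :=
    HasFDerivAt.comp (g := fun s : CSpace n × CSpace n => evalPair Q (H s.1) (K s.2))
      (f := fun x => (x, s.2)) s.1 hS.hasFDerivAt (hasFDerivAt_prodMk_left s.1 s.2)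
  have h2 : HasFDerivAt (fun x => evalPair Q (H x) (K s.2)) _ s.1 :=
    (hasFDerivAt_evalPair Q (H s.1) (K s.2)).comp s.1 hH.hasFDerivAt
  have := congrArg (fun l => l v) (h1.unique h2)
  simpa [_root_.sum_apply] using this

theorem tendsto_graph {ρ : (Fin n → ℂ) × CSpace n → ℂ} {p χ₀ : CSpace n}
    (hρ : AnalyticAt ℂ ρ (p.1, χ₀)) (hρ0 : ρ (p.1, χ₀) = p.2) :
    Tendsto (fun q : (Fin n → ℂ) × CSpace n => ((q.1, ρ q), q.2)) (𝓝 (p.1, χ₀)) (𝓝 (p, χ₀)) := by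
  have : ContinuousAt (fun q : (Fin n → ℂ) × CSpace n => ((q.1, ρ q), q.2)) (p.1, χ₀) :=
    (continuousAt_fst.prodMk hρ.continuousAt).prodMk continuousAt_snd
  have h := this.tendsto
  rw [hρ0] at h
  exact h

theorem dZ_graph_eq_zero {ρ : (Fin n → ℂ) × CSpace n → ℂ} {S : CSpace n × CSpace n → ℂ}
    {p χ₀ : CSpace n} (hρ : AnalyticAt ℂ ρ (p.1, χ₀)) (hρ0 : ρ (p.1, χ₀) = p.2)
    (hS : AnalyticAt ℂ S (p, χ₀)) (h : ∀ᶠ q in 𝓝 (p.1, χ₀), S ((q.1, ρ q), q.2) = 0) :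
    ∀ᶠ q in 𝓝 (p.1, χ₀), ∀ k, fderiv ℂ S ((q.1, ρ q), q.2) ((Pi.single k 1, 0), 0) +
      dZ k ρ q * fderiv ℂ S ((q.1, ρ q), q.2) ((0, 1), 0) = 0 := by
  filter_upwards [h.eventually_nhds,
    (tendsto_graph hρ hρ0).eventually hS.eventually_analyticAt, hρ.eventually_analyticAt]
    with q h1 h2 h3 k
  rw [← dZ_graph h3.differentiableAt h2.differentiableAt, dZ,
    EventuallyEq.fderiv_eq (f := fun _ => (0 : ℂ)) h1]
  simp

/-- If a nonzero polynomial relation `Q(H(z, ρ(z, χ)), K(χ)) = 0` holds on the graph of `ρ`, then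
there is such a relation whose `w`-derivative does not vanish identically on the graph. -/
theorem exists_relation_fderiv_ne_zero {H K : CSpace n → CSpace n} {p χ₀ : CSpace n}
    (hH : AnalyticAt ℂ H p) (hHb : Function.Bijective (fderiv ℂ H p))
    (hK : AnalyticAt ℂ K χ₀) (hKb : Function.Bijective (fderiv ℂ K χ₀))
    {ρ : (Fin n → ℂ) × CSpace n → ℂ} (hρ : AnalyticAt ℂ ρ (p.1, χ₀)) (hρ0 : ρ (p.1, χ₀) = p.2)
    (hQ : ∃ Q : MvPolynomial ((Fin n ⊕ Unit) ⊕ (Fin n ⊕ Unit)) ℂ, Q ≠ 0 ∧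
      ∀ᶠ q in 𝓝 (p.1, χ₀), evalPair Q (H (q.1, ρ q)) (K q.2) = 0) :
    ∃ Q : MvPolynomial ((Fin n ⊕ Unit) ⊕ (Fin n ⊕ Unit)) ℂ, Q ≠ 0 ∧
      (∀ᶠ q in 𝓝 (p.1, χ₀), evalPair Q (H (q.1, ρ q)) (K q.2) = 0) ∧
      ¬ ∀ᶠ q in 𝓝 (p.1, χ₀),
        fderiv ℂ (fun s : CSpace n × CSpace n => evalPair Q (H s.1) (K s.2)) ((q.1, ρ q), q.2)
          ((0, 1), 0) = 0 := by
  classical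
  -- a relation of minimal degree
  obtain ⟨Q, ⟨hQ0, hQv⟩, hmin⟩ := (measure fun Q : MvPolynomial ((Fin n ⊕ Unit) ⊕ (Fin n ⊕ Unit)) ℂ =>
    Q.totalDegree).wf.has_min {Q | Q ≠ 0 ∧
      ∀ᶠ q in 𝓝 (p.1, χ₀), evalPair Q (H (q.1, ρ q)) (K q.2) = 0} hQ
  refine ⟨Q, hQ0, hQv, fun hw => hQ0 ?_⟩
  have hKc (j) : AnalyticAt ℂ (fun χ => coords n (K χ) j) χ₀ :=
    (((ContinuousLinearMap.proj (R := ℂ) (φ := fun _ : Fin n ⊕ Unit => ℂ) j).comp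
      (coords n)).analyticAt _).fun_comp hK
  have hS : AnalyticAt ℂ (fun s : CSpace n × CSpace n => evalPair Q (H s.1) (K s.2)) (p, χ₀) :=
    (isPolyInParameter_evalPair (K := K) hH Q).analyticAt hKc
  have ht := tendsto_graph hρ hρ0
  -- all derivatives of the relation vanish on the graph, contrary to minimality
  have hpd (j : Fin n ⊕ Unit) : MvPolynomial.pderiv (Sum.inl j) Q = 0 := by
    by_contra hne
    refine hmin _ ⟨hne, ?_⟩ (totalDegree_pderiv_lt hne)
    filter_upwards [hw, dZ_graph_eq_zero hρ hρ0 hS hQv, ht.eventually hS.eventually_analyticAt,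
      (continuousAt_fst.tendsto.comp ht).eventually hH.eventually_analyticAt,
      (continuousAt_fst.tendsto.comp ht).eventually (eventually_surjective_fderiv hH hHb)]
      with q h1 h2 h3 h4 h5
    simp only [Function.comp] at h4 h5
    have h6 (v : CSpace n) : fderiv ℂ (fun s : CSpace n × CSpace n => evalPair Q (H s.1) (K s.2))
        ((q.1, ρ q), q.2) (v, 0) = 0 := by
      rw [prodMk_zero_eq_sum, map_add, map_sum, map_smul, h1, smul_zero, add_zero]
      refine Finset.sum_eq_zero fun k _ => ?_
      have := h2 k
      rw [h1, mul_zero, add_zero] at this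
      rw [map_smul, this, smul_zero]
    obtain ⟨v, hv⟩ := h5 (ofCoords n (Pi.single j 1))
    have h7 := h6 v
    rw [fderiv_evalPair_comp h4.differentiableAt h3.differentiableAt] at h7
    simp only [hv, coords_ofCoords] at h7
    simpa [Pi.single_apply] using h7
  have hconst (x x' c : CSpace n) : evalPair Q x c = evalPair Q x' c := by
    refine is_const_of_fderiv_eq_zero (𝕜 := ℂ) (f := fun x => evalPair Q x c)
      (fun x => (hasFDerivAt_evalPair Q x c).differentiableAt) (fun x => ?_) x x'
    rw [(hasFDerivAt_evalPair Q x c).fderiv]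
    refine ContinuousLinearMap.ext fun v => ?_
    simp [hpd, evalPair, _root_.sum_apply]
  have hz : ∀ᶠ χ in 𝓝 χ₀, ∀ x, evalPair Q x (K χ) = 0 := by
    have : Tendsto (fun χ : CSpace n => (p.1, χ)) (𝓝 χ₀) (𝓝 (p.1, χ₀)) :=
      (Continuous.prodMk_right p.1).tendsto χ₀
    filter_upwards [this.eventually hQv] with χ hχ x
    rw [← hχ]
    exact hconst _ _ _
  have hz' := eventually_of_eventually_comp hK hKb (T := fun c => ∀ x, evalPair Q x c = 0) hz
  refine mvPolynomial_eq_zero_of_eventually (v := Sum.elim 0 (coords n (K χ₀))) ?_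
  have hcont : Tendsto (fun u : (Fin n ⊕ Unit) ⊕ (Fin n ⊕ Unit) → ℂ => ofCoords n (u ∘ Sum.inr))
      (𝓝 (Sum.elim 0 (coords n (K χ₀)))) (𝓝 (K χ₀)) := by
    have : Continuous fun u : (Fin n ⊕ Unit) ⊕ (Fin n ⊕ Unit) → ℂ => ofCoords n (u ∘ Sum.inr) :=
      (ofCoords n).continuous.comp (continuous_pi fun i => continuous_apply (Sum.inr i))
    have h := this.tendsto (Sum.elim 0 (coords n (K χ₀)))
    rwa [Sum.elim_comp_inr, ofCoords_coords] at h
  filter_upwards [hcont.eventually hz'] with u hu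
  have := hu (ofCoords n (u ∘ Sum.inl))
  rwa [evalPair, coords_ofCoords, coords_ofCoords, Sum.elim_comp_inl_inr] at this

section GermAlgebra

variable {E : Type*} [NormedAddCommGroup E] [NormedSpace ℂ E] {m : ℕ}

/-- The germ of an analytic function. -/
def analyticGerm {x : E} (f : E → ℂ) (hf : AnalyticAt ℂ f x) : analyticGerms x := ⟨f, f, hf, rfl⟩

/-- A germ of a function of `x`, seen as a germ of a function of `(x, y)`. -/
def fstGermHom (x₀ : E) (y₀ : Fin m → ℂ) : analyticGerms x₀ →+* analyticGerms (x₀, y₀) where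
  toFun g := ⟨g.1.compTendsto Prod.fst (continuous_fst.tendsto (x₀, y₀)), by
    obtain ⟨_, f, hf, rfl⟩ := g
    exact ⟨_, AnalyticAt.fun_comp (f := fun q : E × (Fin m → ℂ) => q.1) hf analyticAt_fst, rfl⟩⟩
  map_one' := rfl
  map_zero' := rfl
  map_add' := by
    rintro ⟨_, f, hf, rfl⟩ ⟨_, g, hg, rfl⟩
    rfl
  map_mul' := by
    rintro ⟨_, f, hf, rfl⟩ ⟨_, g, hg, rfl⟩
    rfl

instance (x₀ : E) (y₀ : Fin m → ℂ) : Algebra (analyticGerms x₀) (analyticGerms (x₀, y₀)) :=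
  (fstGermHom x₀ y₀).toAlgebra

instance (x₀ : E) (y₀ : Fin m → ℂ) :
    FaithfulSMul (analyticGerms x₀) (analyticGerms (x₀, y₀)) := by
  rw [faithfulSMul_iff_algebraMap_injective]
  rintro ⟨_, f, hf, rfl⟩ ⟨_, g, hg, rfl⟩ h
  refine Subtype.ext (Germ.coe_eq.2 ?_)
  have h' := congrArg Subtype.val h
  exact ((Continuous.prodMk_left y₀).tendsto x₀).eventually (Germ.coe_eq.1 h')

theorem analyticAt_snd_apply (x₀ : E) (y₀ : Fin m → ℂ) (j : Fin m) :
    AnalyticAt ℂ (fun q : E × (Fin m → ℂ) => q.2 j) (x₀, y₀) :=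
  ((ContinuousLinearMap.proj (R := ℂ) (φ := fun _ : Fin m => ℂ) j).analyticAt _).fun_comp
    analyticAt_snd

/-- The germ of the coordinate `yⱼ`. -/
def sndGerm (x₀ : E) (y₀ : Fin m → ℂ) (j : Fin m) : analyticGerms (x₀, y₀) :=
  analyticGerm _ (analyticAt_snd_apply x₀ y₀ j)

/-- The coordinates `yⱼ` are algebraically independent over the functions of `x`. -/
theorem algebraicIndependent_sndGerm (x₀ : E) (y₀ : Fin m → ℂ) :
    AlgebraicIndependent (analyticGerms x₀) (sndGerm x₀ y₀) := by
  rw [algebraicIndependent_iff]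
  have key (P : MvPolynomial (Fin m) (analyticGerms x₀)) : ∃ F : E → MvPolynomial (Fin m) ℂ,
      (MvPolynomial.aeval (sndGerm x₀ y₀) P).1 =
        ((fun q => MvPolynomial.eval q.2 (F q.1) : E × (Fin m → ℂ) → ℂ) : Germ _ ℂ) ∧
      ∀ d, (P.coeff d).1 = ((fun x => (F x).coeff d : E → ℂ) : Germ _ ℂ) := by
    classical
    induction P using MvPolynomial.induction_on with
    | C a =>
      obtain ⟨_, f, hf, rfl⟩ := a
      refine ⟨fun x => MvPolynomial.C (f x), ?_, fun d => ?_⟩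
      · simp only [MvPolynomial.algHom_C, MvPolynomial.eval_C]
        rfl
      · simp only [MvPolynomial.coeff_C]
        split_ifs <;> rfl
    | add P Q hP hQ =>
      obtain ⟨F, h1, h2⟩ := hP
      obtain ⟨G, h3, h4⟩ := hQ
      refine ⟨fun x => F x + G x, ?_, fun d => ?_⟩
      · simp only [map_add]
        rw [Subring.coe_add, h1, h3]
        rfl
      · simp only [MvPolynomial.coeff_add]
        rw [Subring.coe_add, h2, h4]
        rfl
    | mul_X P i hP =>
      obtain ⟨F, h1, h2⟩ := hP
      refine ⟨fun x => F x * MvPolynomial.X i, ?_, fun d => ?_⟩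
      · simp only [map_mul, MvPolynomial.aeval_X, MvPolynomial.eval_X]
        rw [Subring.coe_mul, h1]
        rfl
      · simp only [MvPolynomial.coeff_mul_X']
        split_ifs
        · exact h2 _
        · rfl
  intro P hP
  obtain ⟨F, h1, h2⟩ := key P
  rw [hP] at h1
  have h3 : ∀ᶠ q : E × (Fin m → ℂ) in 𝓝 (x₀, y₀), MvPolynomial.eval q.2 (F q.1) = 0 :=
    Germ.coe_eq.1 h1.symm
  have h4 : ∀ᶠ x in 𝓝 x₀, F x = 0 := by
    filter_upwards [h3.curry_nhds] with x hx
    exact mvPolynomial_eq_zero_of_eventually hx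
  ext d
  rw [h2 d]
  refine Germ.coe_eq.2 ?_
  filter_upwards [h4] with x hx
  rw [hx]
  rfl

/-- Algebraicity over the analytic germs in `x` with the coordinates `yⱼ` adjoined is
algebraicity in `y`. -/
theorem isAlgebraicInSecond_of_isAlgebraic_adjoin {x₀ : E} {y₀ : Fin m → ℂ}
    {f : E × (Fin m → ℂ) → ℂ} {a : analyticGerms (x₀, y₀)} (ha : a.1 = (f : Germ _ ℂ))
    (h : IsAlgebraic (Algebra.adjoin (analyticGerms x₀) (Set.range (sndGerm x₀ y₀))) a) :
    IsAlgebraicInSecond x₀ y₀ f := by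
  have hmem (b : Algebra.adjoin (analyticGerms x₀) (Set.range (sndGerm x₀ y₀))) :
      b.1.1 ∈ pseudoPolyRing x₀ y₀ := by
    obtain ⟨b, hb⟩ := b
    change b.1 ∈ pseudoPolyRing x₀ y₀
    induction hb using Algebra.adjoin_induction with
    | mem x hx =>
      obtain ⟨j, rfl⟩ := hx
      exact Subring.subset_closure (Or.inr ⟨j, rfl⟩)
    | algebraMap r =>
      obtain ⟨_, g, hg, rfl⟩ := r
      exact Subring.subset_closure (Or.inl ⟨g, hg, rfl⟩)
    | add x y _ _ hx hy => exact add_mem hx hy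
    | mul x y _ _ hx hy => exact mul_mem hx hy
  let φ : Algebra.adjoin (analyticGerms x₀) (Set.range (sndGerm x₀ y₀)) →+* pseudoPolyRing x₀ y₀ :=
    RingHom.codRestrict ((analyticGerms (x₀, y₀)).subtype.comp
      (Algebra.adjoin (analyticGerms x₀) (Set.range (sndGerm x₀ y₀))).val.toRingHom) _ hmem
  have hφ : Function.Injective φ := fun b b' hb =>
    Subtype.ext (Subtype.ext (congrArg (fun c : pseudoPolyRing x₀ y₀ => c.1) hb))
  have := h.ringHom_of_comp_eq φ (analyticGerms (x₀, y₀)).subtype hφ rfl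
  change IsAlgebraic (pseudoPolyRing x₀ y₀) a.1 at this
  rw [ha] at this
  exact this

end GermAlgebra

section Algebraizable

variable {m : ℕ} {p : CSpace n} {y₀ : Fin m → ℂ}

/-- Functions polynomial in `cⱼ(χ)`, after a substitution `χ = A(x, y)`. -/
theorem IsPolyInParameter.exists_mem_adjoin {κ : Type*} {c : κ → CSpace n → ℂ}
    {f : CSpace n × CSpace n → ℂ} (hf : IsPolyInParameter p c f)
    {A : CSpace n × (Fin m → ℂ) → CSpace n} {C : κ → analyticGerms (p, y₀)}
    (hC : ∀ j, (C j).1 = ((fun t => c j (A t) : CSpace n × (Fin m → ℂ) → ℂ) : Germ _ ℂ)) :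
    ∃ a ∈ Algebra.adjoin (analyticGerms p) (Set.range C),
      a.1 = ((fun t => f (t.1, A t) : CSpace n × (Fin m → ℂ) → ℂ) : Germ _ ℂ) := by
  induction hf with
  | coeff a ha => exact ⟨_, Subalgebra.algebraMap_mem _ (analyticGerm a ha), rfl⟩
  | var j => exact ⟨C j, Algebra.subset_adjoin ⟨j, rfl⟩, hC j⟩
  | add _ _ hf hg =>
    obtain ⟨a, ha, ha'⟩ := hf
    obtain ⟨b, hb, hb'⟩ := hg
    refine ⟨a + b, add_mem ha hb, ?_⟩
    rw [Subring.coe_add, ha', hb']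
    rfl
  | mul _ _ hf hg =>
    obtain ⟨a, ha, ha'⟩ := hf
    obtain ⟨b, hb, hb'⟩ := hg
    refine ⟨a * b, mul_mem ha hb, ?_⟩
    rw [Subring.coe_mul, ha', hb']
    rfl

/-- A nontrivial polynomial relation between `H(x)` and `c(x, y)` is an algebraic dependence of the
components of `c` over the functions of `x`. -/
theorem not_algebraicIndependent_of_relation {H : CSpace n → CSpace n} (hH : AnalyticAt ℂ H p)
    (hHb : Function.Bijective (fderiv ℂ H p))
    {Q : MvPolynomial ((Fin n ⊕ Unit) ⊕ (Fin n ⊕ Unit)) ℂ} (hQ : Q ≠ 0)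
    {c : CSpace n × (Fin m → ℂ) → CSpace n} {C : Fin n ⊕ Unit → analyticGerms (p, y₀)}
    (hC : ∀ j, (C j).1 = ((fun t => coords n (c t) j : CSpace n × (Fin m → ℂ) → ℂ) : Germ _ ℂ))
    (h : ∀ᶠ t in 𝓝 (p, y₀), evalPair Q (H t.1) (c t) = 0) :
    ¬ AlgebraicIndependent (analyticGerms p) C := by
  have key (Q : MvPolynomial ((Fin n ⊕ Unit) ⊕ (Fin n ⊕ Unit)) ℂ) :
      ∃ P : MvPolynomial (Fin n ⊕ Unit) (analyticGerms p),
        (MvPolynomial.aeval C P).1 =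
          ((fun t => evalPair Q (H t.1) (c t) : CSpace n × (Fin m → ℂ) → ℂ) : Germ _ ℂ) ∧
        ∀ b : CSpace n, MvPolynomial.aeval
          (fun j => ((fun _ => coords n b j : CSpace n → ℂ) : Germ (𝓝 p) ℂ)) P =
            ((fun x => evalPair Q (H x) b : CSpace n → ℂ) : Germ _ ℂ) := by
    induction Q using MvPolynomial.induction_on with
    | C a =>
      refine ⟨MvPolynomial.C (analyticGerm (fun _ => a) analyticAt_const), ?_, fun b => ?_⟩
      · simp only [MvPolynomial.algHom_C, evalPair, MvPolynomial.eval_C]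
        rfl
      · simp only [MvPolynomial.algHom_C, evalPair, MvPolynomial.eval_C]
        rfl
    | add P Q hP hQ =>
      obtain ⟨P', h1, h2⟩ := hP
      obtain ⟨Q', h3, h4⟩ := hQ
      refine ⟨P' + Q', ?_, fun b => ?_⟩
      · rw [map_add, Subring.coe_add, h1, h3]
        simp only [evalPair, map_add]
        rfl
      · rw [map_add, h2, h4]
        simp only [evalPair, map_add]
        rfl
    | mul_X P i hP =>
      obtain ⟨P', h1, h2⟩ := hP
      rcases i with i | i
      · have hi : AnalyticAt ℂ (fun x => coords n (H x) i) p :=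
          (((ContinuousLinearMap.proj (R := ℂ) (φ := fun _ : Fin n ⊕ Unit => ℂ) i).comp
            (coords n)).analyticAt _).fun_comp hH
        refine ⟨P' * MvPolynomial.C (analyticGerm _ hi), ?_, fun b => ?_⟩
        · rw [map_mul, Subring.coe_mul, h1, MvPolynomial.algHom_C]
          simp only [evalPair, map_mul, MvPolynomial.eval_X, Sum.elim_inl]
          rfl
        · rw [map_mul, h2, MvPolynomial.algHom_C]
          simp only [evalPair, map_mul, MvPolynomial.eval_X, Sum.elim_inl]
          rfl
      · refine ⟨P' * MvPolynomial.X i, ?_, fun b => ?_⟩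
        · rw [map_mul, Subring.coe_mul, h1, MvPolynomial.aeval_X, hC]
          simp only [evalPair, map_mul, MvPolynomial.eval_X, Sum.elim_inr]
          rfl
        · rw [map_mul, h2, MvPolynomial.aeval_X]
          simp only [evalPair, map_mul, MvPolynomial.eval_X, Sum.elim_inr]
          rfl
  intro hind
  obtain ⟨P, h1, h2⟩ := key Q
  have hP0 : P = 0 := by
    refine (algebraicIndependent_iff.1 hind) P (Subtype.ext ?_)
    rw [h1]
    exact Germ.coe_eq.2 h
  apply hQ
  have hz (b x : CSpace n) : evalPair Q x b = 0 := by
    have h3 := h2 b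
    rw [hP0, map_zero] at h3
    have h4 := eventually_of_eventually_comp hH hHb (T := fun x => evalPair Q x b = 0)
      (Germ.coe_eq.1 h3.symm)
    let Q' : MvPolynomial (Fin n ⊕ Unit) ℂ :=
      MvPolynomial.bind₁ (Sum.elim MvPolynomial.X fun j => MvPolynomial.C (coords n b j)) Q
    have hQ' (u : Fin n ⊕ Unit → ℂ) :
        MvPolynomial.eval u Q' = evalPair Q (ofCoords n u) b := by
      rw [evalPair, coords_ofCoords]
      simp only [Q']
      rw [← MvPolynomial.coe_aeval_eq_eval, RingHom.coe_coe, MvPolynomial.aeval_bind₁,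
        ← MvPolynomial.coe_aeval_eq_eval, RingHom.coe_coe]
      congr 2
      funext i
      rcases i with i | i <;> simp
    have h5 : Q' = 0 := by
      refine mvPolynomial_eq_zero_of_eventually (v := coords n (H p)) ?_
      have : Tendsto (ofCoords n) (𝓝 (coords n (H p))) (𝓝 (H p)) := by
        have := (ofCoords n).continuous.tendsto (coords n (H p))
        rwa [ofCoords_coords] at this
      filter_upwards [this.eventually h4] with u hu
      rw [hQ', hu]
    have := hQ' (coords n x)
    rw [h5, map_zero, ofCoords_coords] at this
    exact this.symm
  refine MvPolynomial.funext fun u => ?_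
  have := hz (ofCoords n (u ∘ Sum.inr)) (ofCoords n (u ∘ Sum.inl))
  rwa [evalPair, coords_ofCoords, coords_ofCoords, Sum.elim_comp_inl_inr, ← map_zero
    (MvPolynomial.eval u)] at this

end Algebraizable

/-- If the graphs of `ρ(·, χ)` satisfy a polynomial relation in suitable local coordinates `H` of
the ambient space and `K` of the space of parameters, the system is algebraic in `w'`. -/
theorem isAlgebraicInSecond_jetSystem {p χ₀ : CSpace n} {η : Fin n → ℂ}
    {H K : CSpace n → CSpace n}
    (hH : AnalyticAt ℂ H p) (hHb : Function.Bijective (fderiv ℂ H p))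
    (hK : AnalyticAt ℂ K χ₀) (hKb : Function.Bijective (fderiv ℂ K χ₀))
    {ρ : (Fin n → ℂ) × CSpace n → ℂ} (hρ : AnalyticAt ℂ ρ (p.1, χ₀)) (hρ0 : ρ (p.1, χ₀) = p.2)
    (hη : jetMap ρ (p.1, χ₀) = (p, η))
    {G : CSpace n × (Fin n → ℂ) → (Fin n → ℂ) × CSpace n} (hG : AnalyticAt ℂ G (p, η))
    (hG0 : G (p, η) = (p.1, χ₀)) (hJG : ∀ᶠ t in 𝓝 (p, η), jetMap ρ (G t) = t)
    (hGJ : ∀ᶠ q in 𝓝 (p.1, χ₀), G (jetMap ρ q) = q)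
    (hQ : ∃ Q : MvPolynomial ((Fin n ⊕ Unit) ⊕ (Fin n ⊕ Unit)) ℂ, Q ≠ 0 ∧
      ∀ᶠ q in 𝓝 (p.1, χ₀), evalPair Q (H (q.1, ρ q)) (K q.2) = 0) (k l : Fin n) :
    IsAlgebraicInSecond p η (jetSystem ρ G k l) := by
  obtain ⟨Q, hQ0, hQv, hQw⟩ := exists_relation_fderiv_ne_zero hH hHb hK hKb hρ hρ0 hQ
  let c : Fin n ⊕ Unit → CSpace n → ℂ := fun j χ => coords n (K χ) j
  have hc (j) : AnalyticAt ℂ (c j) χ₀ :=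
    (((ContinuousLinearMap.proj (R := ℂ) (φ := fun _ : Fin n ⊕ Unit => ℂ) j).comp
      (coords n)).analyticAt _).fun_comp hK
  let S : CSpace n × CSpace n → ℂ := fun s => evalPair Q (H s.1) (K s.2)
  have hSP : IsPolyInParameter p c S := isPolyInParameter_evalPair (K := K) hH Q
  have hSA : AnalyticAt ℂ S (p, χ₀) := hSP.analyticAt hc
  -- the derivatives of the relation
  have hSl := fun l : Fin n => hSP.exists_fderiv hc (Pi.single l 1, 0)
  choose Sz hSz hSz' using hSl
  obtain ⟨Sw, hSw, hSw'⟩ := hSP.exists_fderiv hc (0, 1)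
  have ht := tendsto_graph hρ hρ0
  have hfirst : ∀ᶠ q in 𝓝 (p.1, χ₀), ∀ l,
      Sz l ((q.1, ρ q), q.2) + dZ l ρ q * Sw ((q.1, ρ q), q.2) = 0 := by
    filter_upwards [dZ_graph_eq_zero hρ hρ0 hSA hQv, ht.eventually (eventually_all.2 hSz'),
      ht.eventually hSw'] with q h1 h2 h3 l
    rw [← h2, ← h3]
    exact h1 l
  obtain ⟨Szz, hSzz, hSzz'⟩ := (hSz l).exists_fderiv hc (Pi.single k 1, 0)
  obtain ⟨Szw, hSzw, hSzw'⟩ := (hSz l).exists_fderiv hc (0, 1)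
  obtain ⟨Swz, hSwz, hSwz'⟩ := hSw.exists_fderiv hc (Pi.single k 1, 0)
  obtain ⟨Sww, hSww, hSww'⟩ := hSw.exists_fderiv hc (0, 1)
  have hsecond : ∀ᶠ q in 𝓝 (p.1, χ₀),
      (Szz ((q.1, ρ q), q.2) + dZ k ρ q * Szw ((q.1, ρ q), q.2)) +
        (dZ l ρ q * (Swz ((q.1, ρ q), q.2) + dZ k ρ q * Sww ((q.1, ρ q), q.2)) +
          Sw ((q.1, ρ q), q.2) * dZ k (dZ l ρ) q) = 0 := by
    filter_upwards [hfirst.eventually_nhds, ht.eventually hSzz', ht.eventually hSzw',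
      ht.eventually hSwz', ht.eventually hSww', hρ.eventually_analyticAt,
      ht.eventually ((hSz l).analyticAt hc).eventually_analyticAt,
      ht.eventually (hSw.analyticAt hc).eventually_analyticAt] with q h1 h2 h3 h4 h5 h6 h7 h8
    have e1 := (hasFDerivAt_graph h6.differentiableAt h7.differentiableAt).differentiableAt
    have e2 := (hasFDerivAt_graph h6.differentiableAt h8.differentiableAt).differentiableAt
    have e3 := (analyticAt_dZ (k := l) h6).differentiableAt
    have e4 : dZ k (fun q => Sz l ((q.1, ρ q), q.2) + dZ l ρ q * Sw ((q.1, ρ q), q.2)) q = 0 := by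
      rw [dZ, EventuallyEq.fderiv_eq (f := fun _ => (0 : ℂ)) (h1.mono fun q hq => hq l)]
      simp
    rw [dZ, fderiv_fun_add e1 (e3.fun_mul e2), fderiv_fun_mul e3 e2] at e4
    rw [← h2, ← h3, ← h4, ← h5, ← dZ_graph h6.differentiableAt h7.differentiableAt,
      ← dZ_graph h6.differentiableAt h8.differentiableAt]
    exact e4
  -- transport to the jet coordinates
  let A : CSpace n × (Fin n → ℂ) → CSpace n := fun t => (G t).2
  have hA : AnalyticAt ℂ A (p, η) := analyticAt_snd.fun_comp hG
  have hA0 : A (p, η) = χ₀ := by simp only [A, hG0]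
  have hGt : Tendsto G (𝓝 (p, η)) (𝓝 (p.1, χ₀)) := by
    have := hG.continuousAt.tendsto
    rwa [hG0] at this
  have hCA (j) : AnalyticAt ℂ (fun t => c j (A t)) (p, η) :=
    AnalyticAt.fun_comp (by rw [hA0]; exact hc j) hA
  let C : Fin n ⊕ Unit → analyticGerms (p, η) := fun j => analyticGerm _ (hCA j)
  have hC (j) : (C j).1 = ((fun t => c j (A t) : CSpace n × (Fin n → ℂ) → ℂ) : Germ _ ℂ) := rfl
  have hgr : ∀ᶠ t in 𝓝 (p, η), (((G t).1, ρ (G t)), (G t).2) = (t.1, A t) ∧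
      ∀ j, dZ j ρ (G t) = t.2 j := by
    filter_upwards [hJG] with t ht
    exact ⟨by rw [← congrArg Prod.fst ht]; rfl, fun j => congrArg (fun s => s.2 j) ht⟩
  let y := sndGerm p η
  have hrel : ∀ᶠ t in 𝓝 (p, η), evalPair Q (H t.1) (K (A t)) = 0 := by
    filter_upwards [hGt.eventually hQv, hgr] with t h1 h2
    have h3 : ((G t).1, ρ (G t)) = t.1 := congrArg Prod.fst h2.1
    rw [h3] at h1
    exact h1
  obtain ⟨aw, haw, haw'⟩ := hSw.exists_mem_adjoin hC
  have haz := fun l => (hSz l).exists_mem_adjoin hC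
  choose az haz haz' using haz
  obtain ⟨azz, hazz, hazz'⟩ := hSzz.exists_mem_adjoin hC
  obtain ⟨azw, hazw, hazw'⟩ := hSzw.exists_mem_adjoin hC
  obtain ⟨awz, hawz, hawz'⟩ := hSwz.exists_mem_adjoin hC
  obtain ⟨aww, haww, haww'⟩ := hSww.exists_mem_adjoin hC
  have hΦA : AnalyticAt ℂ (jetSystem ρ G k l) (p, η) := by
    refine AnalyticAt.fun_comp (g := dZ k (dZ l ρ)) (f := G) ?_ hG
    rw [hG0]
    exact analyticAt_dZ (analyticAt_dZ hρ)
  let Φ : analyticGerms (p, η) := analyticGerm _ hΦA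
  have haw0 : aw ≠ 0 := by
    intro h0
    have h1 : ∀ᶠ t in 𝓝 (p, η), Sw (t.1, A t) = 0 := by
      rw [h0] at haw'
      exact Germ.coe_eq.1 haw'.symm
    have hJt : Tendsto (jetMap ρ) (𝓝 (p.1, χ₀)) (𝓝 (p, η)) := by
      have := (analyticAt_jetMap hρ).continuousAt.tendsto
      rwa [hη] at this
    refine hQw ?_
    filter_upwards [hJt.eventually h1, hGJ, ht.eventually hSw'] with q h2 h3 h4
    refine h4.trans ?_
    simp only [A, h3] at h2
    exact h2
  have e1 (j : Fin n) : az j + y j * aw = 0 := by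
    refine Subtype.ext ?_
    rw [Subring.coe_add, Subring.coe_mul, haz', haw']
    refine Germ.coe_eq.2 ?_
    filter_upwards [hGt.eventually hfirst, hgr] with t h1 h2
    have := h1 j
    rw [h2.1, h2.2] at this
    exact this
  have e2 : (azz + y k * azw) + (y l * (awz + y k * aww) + aw * Φ) = 0 := by
    refine Subtype.ext ?_
    simp only [Subring.coe_add, Subring.coe_mul, hazz', hazw', hawz', haww', haw']
    refine Germ.coe_eq.2 ?_
    filter_upwards [hGt.eventually hsecond, hgr] with t h1 h2
    rw [h2.1, h2.2, h2.2] at h1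
    exact h1
  -- algebra
  have hyC (j : Fin n) :
      IsAlgebraic (Algebra.adjoin (analyticGerms p) (Set.range C)) (y j) := by
    refine IsAlgebraic.of_mul (mem_nonZeroDivisors_of_ne_zero haw0)
      (isAlgebraic_algebraMap (⟨aw, haw⟩ : Algebra.adjoin (analyticGerms p) (Set.range C))) ?_
    have : aw * y j = -az j := by linear_combination e1 j
    rw [this]
    exact (isAlgebraic_algebraMap
      (⟨az j, haz j⟩ : Algebra.adjoin (analyticGerms p) (Set.range C))).neg
  have hcy := isAlgebraic_adjoin_of_exchange (by simp) (algebraicIndependent_sndGerm p η)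
    (not_algebraicIndependent_of_relation hH hHb hQ0 hC hrel) hyC
  have hle {a : analyticGerms (p, η)} (ha : a ∈ Algebra.adjoin (analyticGerms p) (Set.range C)) :
      IsAlgebraic (Algebra.adjoin (analyticGerms p) (Set.range y)) a := by
    induction ha using Algebra.adjoin_induction with
    | mem x hx =>
      obtain ⟨j, rfl⟩ := hx
      exact hcy j
    | algebraMap r =>
      exact isAlgebraic_algebraMap
        (algebraMap (analyticGerms p) (Algebra.adjoin (analyticGerms p) (Set.range y)) r)
    | add _ _ _ _ hx hy => exact hx.add hy
    | mul _ _ _ _ hx hy => exact hx.mul hy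
  have hyy (j : Fin n) : IsAlgebraic (Algebra.adjoin (analyticGerms p) (Set.range y)) (y j) :=
    isAlgebraic_algebraMap
      (⟨y j, Algebra.subset_adjoin ⟨j, rfl⟩⟩ : Algebra.adjoin (analyticGerms p) (Set.range y))
  refine isAlgebraicInSecond_of_isAlgebraic_adjoin (a := Φ) rfl ?_
  refine IsAlgebraic.of_mul (mem_nonZeroDivisors_of_ne_zero haw0) (hle haw) ?_
  have : aw * Φ = -((azz + y k * azw) + y l * (awz + y k * aww)) := by linear_combination e2
  rw [this]
  exact (((hle hazz).add ((hyy k).mul (hle hazw))).add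
    ((hyy l).mul ((hle hawz).add ((hyy k).mul (hle haww))))).neg

theorem bijective_fderiv_star_star {H : CSpace n → CSpace n} {p : CSpace n}
    (hH : DifferentiableAt ℂ H p) (hb : Function.Bijective (fderiv ℂ H p)) :
    Function.Bijective (fderiv ℂ (fun χ => star (H (star χ))) (star p)) := by
  have h : HasFDerivAt (star ∘ H ∘ star) _ (star p) := hH.hasFDerivAt.star_star
  have h' : fderiv ℂ (fun χ => star (H (star χ))) (star p) = _ := h.fderiv
  rw [h']
  exact (star_involutive.bijective.comp hb).comp star_involutive.bijective

/-- The system associated with an algebraizable hypersurface is algebraic in `w'`. -/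
theorem IsAlgebraizableAt.isAlgebraicInSecond_jetSystem {M : Set (CSpace n)} {p : CSpace n}
    (hM : IsAlgebraizableAt M p) {ρ : (Fin n → ℂ) × CSpace n → ℂ}
    (hρ : IsComplexDefiningFunctionAt M p ρ)
    (hv : ∀ h : CSpace n × CSpace n → ℂ, AnalyticAt ℂ h (p, star p) →
        (∀ᶠ x in 𝓝 p, x ∈ M → h (x, star x) = 0) →
        ∀ᶠ q in 𝓝 (p.1, star p), h ((q.1, ρ q), q.2) = 0) {η : Fin n → ℂ}
    (hη : jetMap ρ (p.1, star p) = (p, η))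
    {G : CSpace n × (Fin n → ℂ) → (Fin n → ℂ) × CSpace n} (hG : AnalyticAt ℂ G (p, η))
    (hG0 : G (p, η) = (p.1, star p)) (hJG : ∀ᶠ t in 𝓝 (p, η), jetMap ρ (G t) = t)
    (hGJ : ∀ᶠ q in 𝓝 (p.1, star p), G (jetMap ρ q) = q) (k l : Fin n) :
    IsAlgebraicInSecond p η (jetSystem ρ G k l) := by
  obtain ⟨M', q, ⟨-, P, hP, hPM⟩, H, hH, hHb, hHp, hHM⟩ := hM
  obtain ⟨Q, hQ, hQP⟩ := exists_polarization hP
  have hK := analyticAt_star_star hH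
  refine JetTranscendence.isAlgebraicInSecond_jetSystem hH hHb hK
    (bijective_fderiv_star_star hH.differentiableAt hHb) hρ.analyticAt hρ.map_base hη hG hG0 hJG hGJ
    ⟨Q, hQ, ?_⟩ k l
  have hS : AnalyticAt ℂ
      (fun s : CSpace n × CSpace n => evalPair Q (H s.1) (star (H (star s.2)))) (p, star p) :=
    (isPolyInParameter_evalPair (K := fun χ => star (H (star χ))) hH Q).analyticAt fun j =>
      (((ContinuousLinearMap.proj (R := ℂ) (φ := fun _ : Fin n ⊕ Unit => ℂ) j).comp
        (coords n)).analyticAt _).fun_comp hK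
  refine hv _ hS ?_
  have hHt : Tendsto H (𝓝 p) (𝓝 q) := hHp ▸ hH.continuousAt.tendsto
  filter_upwards [hHM, hHt.eventually hPM] with x h1 h2 h3
  rw [star_star, hQP, h2 (h1.1 h3), Complex.ofReal_zero]

theorem IsAssociatedSystemAt.analyticAt {M : Set (CSpace n)} {p : CSpace n} {η : Fin n → ℂ}
    {Φ : Fin n → Fin n → CSpace n × (Fin n → ℂ) → ℂ} (h : IsAssociatedSystemAt M p η Φ)
    (k l : Fin n) : AnalyticAt ℂ (Φ k l) (p, η) := by
  obtain ⟨_, _, _, h, _⟩ := h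
  exact h k l

end JetTranscendence

end

open JetTranscendence

theorem mainTheorem3 {n : ℕ} (hn : 1 ≤ n)
    (M : Set (JetTranscendence.CSpace n)) (p : JetTranscendence.CSpace n)
    (hLevi : JetTranscendence.IsLeviNondegenerateAt M p)
    (hw : JetTranscendence.IsTransverseAt M p) :
    (∃ η Φ, JetTranscendence.IsAssociatedSystemAt M p η Φ) ∧
    (∀ η Φ, JetTranscendence.IsAssociatedSystemAt M p η Φ →
      (JetTranscendence.jetTranscendenceDegree M p < ⊤ ↔
        ∀ k l, JetTranscendence.IsAlgebraicInSecond p η (Φ k l))) ∧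
    (JetTranscendence.IsAlgebraizableAt M p →
      JetTranscendence.jetTranscendenceDegree M p < ⊤ ∧
      ∀ η Φ, JetTranscendence.IsAssociatedSystemAt M p η Φ →
        ∀ k l, JetTranscendence.IsAlgebraicInSecond p η (Φ k l)) := by
  obtain ⟨ρ, hρ, hv, hb⟩ := exists_segreFamily hLevi hw
  obtain ⟨G, hG, hG0, hJG, hGJ⟩ :=
    exists_analytic_local_inverse (analyticAt_jetMap hρ.analyticAt) hb
  obtain ⟨η, hη⟩ : ∃ η, jetMap ρ (p.1, star p) = (p, η) :=
    ⟨_, Prod.ext (Prod.ext rfl hρ.map_base) rfl⟩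
  rw [hη] at hG hG0 hJG
  have hsys := isAssociatedSystemAt_jetSystem hρ hη hG hG0 hGJ
  have huniq {η' Φ} (h : IsAssociatedSystemAt M p η' Φ) :=
    h.eventuallyEq_jetSystem hv hη hG hG0 hJG
  have hlt (η' Φ) (h : IsAssociatedSystemAt M p η' Φ) :
      transcendenceDegree p η' (fun i : Fin n ×ₗ Fin n => Φ (ofLex i).1 (ofLex i).2) < ⊤ ↔
        ∀ k l, IsAlgebraicInSecond p η' (Φ k l) := by
    rw [transcendenceDegree_lt_top_iff fun i => h.analyticAt _ _]
    exact ⟨fun h k l => h (toLex (k, l)), fun h i => h _ _⟩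
  have hcongr (η' Φ) (h : IsAssociatedSystemAt M p η' Φ) :
      (∀ k l, IsAlgebraicInSecond p η' (Φ k l)) ↔
        ∀ k l, IsAlgebraicInSecond p η (jetSystem ρ G k l) := by
    obtain ⟨rfl, he⟩ := huniq h
    exact ⟨fun h k l => (h k l).congr (he k l), fun h k l => (h k l).congr (he k l).symm⟩
  have hdeg : jetTranscendenceDegree M p < ⊤ ↔
      ∀ k l, IsAlgebraicInSecond p η (jetSystem ρ G k l) := by
    simp only [jetTranscendenceDegree, iInf_lt_iff]
    constructor
    · rintro ⟨η', Φ, h, hd⟩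
      exact (hcongr η' Φ h).1 ((hlt η' Φ h).1 hd)
    · exact fun h => ⟨η, jetSystem ρ G, hsys, (hlt _ _ hsys).2 h⟩
  refine ⟨⟨η, jetSystem ρ G, hsys⟩, fun η' Φ h => hdeg.trans (hcongr η' Φ h).symm, fun hM => ?_⟩
  have halg := fun k l => hM.isAlgebraicInSecond_jetSystem hρ hv hη hG hG0 hJG hGJ k l
  exact ⟨hdeg.2 halg, fun η' Φ h => (hcongr η' Φ h).2 halg⟩
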